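/- Let $V$ be a unitary space of finite dimension $\ell$ over $\mathbf C$, and let $W\subset \mathbf{GL}(V)$ be a finite group generated by unitary reflections. Let $S$ be the algebra of polynomial functions on $V$, $\mathrm{Der}_S$ the $S$-module of $\mathbf C$-derivations of $S$, $\Omega^1=\mathrm{Hom}_S(\mathrm{Der}_S,S)$ and $\Omega^p=\bigwedge^p_S\Omega^1$ (so $\Omega^0=S$), all with their natural $W$-actions, where $W$ acts on $V^*$ contragrediently. Let $R=S^W$, and let $(\Omega^p)^{\det^{-1}}=\{\omega\in\Omega^p \mid w\omega=\det(w)^{-1}\omega \text{ for all } w\in W\}$ be the $R$-module of anti-invariant $p$-forms. For each reflecting hyperplane $H$ of $W$ choose a linear form $\alpha_H\in V^*$ with kernel $H$, and put $Q=\prod_H\alpha_H$. Let $K$ be the fraction field of $S$; rational $p$-forms are the elements of $\bigwedge^p_K \mathrm{Hom}_S(\mathrm{Der}_S,K)$. Then for $0\le p\le \ell$ the natural map from the exterior power $\bigwedge_R^p(\Omega^1)^{\det^{-1}}$ to rational $p$-forms is injective and, identifying $\bigwedge_R^p(\Omega^1)^{\det^{-1}}$ with its image, $$(\Omega^p)^{\det^{-1}}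 = Q^{1-p}\bigwedge\nolimits_R^p(\Omega^1)^{\det^{-1}}$$ inside the rational $p$-forms (for $p=0$ the exterior power is $R$). Moreover, the $R$-module $\mathrm{Der}_S^W$ of invariant derivations is free of rank $\ell$; for every $R$-basis $\theta_1,\dots,\theta_\ell$ of it there are unique rational $1$-forms $\omega_1,\dots,\omega_\ell$ with $\omega_j(\theta_i)=\delta_{ij}$; and for $0\le p\le\ell$ the forms $$Q\,(\omega_{i_1}\wedge\cdots\wedge\omega_{i_p}),\qquad 1\le i_1<\cdots<i_p\le\ell,$$ are an $R$-basis of both sides of the displayed equality. -/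

import Mathlib

open Module
open scoped Pointwise

noncomputable section

namespace ReflForms

/-! ### Ring homomorphisms out of an exterior algebra, semilinear in the base ring -/

section ExteriorMap

variable {A B M N : Type*} [CommRing A] [CommRing B] [AddCommGroup M] [Module A M]
  [AddCommGroup N] [Module B N]

/-- The ring homomorphism `ExteriorAlgebra A M →+* E` determined by a ring homomorphism
`τ : A →+* E` with central values and an additive map `f : M →+ E` that is semilinear along `τ`
and has values of square zero. -/
def extLift {E : Type*} [Ring E] (τ : A →+* E) (hτ : ∀ a e, τ a * e = e * τ a) (f : M →+ E)
    (hf : ∀ a m, f (a • m) = τ a * f m) (hsq : ∀ m, f m * f m = 0) :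
    ExteriorAlgebra A M →+* E :=
  letI : Algebra A E := τ.toAlgebra' hτ
  (ExteriorAlgebra.lift A
    ⟨{ toFun := f, map_add' := f.map_add, map_smul' := hf }, hsq⟩).toRingHom

theorem extLift_ι {E : Type*} [Ring E] (τ : A →+* E) (hτ : ∀ a e, τ a * e = e * τ a)
    (f : M →+ E) (hf : ∀ a m, f (a • m) = τ a * f m) (hsq : ∀ m, f m * f m = 0) (m : M) :
    extLift τ hτ f hf hsq (ExteriorAlgebra.ι A m) = f m := by
  let _ : Algebra A E := τ.toAlgebra' hτ
  exact ExteriorAlgebra.lift_ι_apply A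
    ({ toFun := f, map_add' := f.map_add, map_smul' := hf } : M →ₗ[A] E) hsq m

theorem extLift_algebraMap {E : Type*} [Ring E] (τ : A →+* E) (hτ : ∀ a e, τ a * e = e * τ a)
    (f : M →+ E) (hf : ∀ a m, f (a • m) = τ a * f m) (hsq : ∀ m, f m * f m = 0) (a : A) :
    extLift τ hτ f hf hsq (algebraMap A _ a) = τ a := by
  let _ : Algebra A E := τ.toAlgebra' hτ
  exact AlgHom.commutes (ExteriorAlgebra.lift A
    ⟨({ toFun := f, map_add' := f.map_add, map_smul' := hf } : M →ₗ[A] E), hsq⟩) a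

/-- The map of exterior algebras
`a · m₁ ∧ ⋯ ∧ mₚ ↦ σ a · f m₁ ∧ ⋯ ∧ f mₚ` induced by a `σ`-semilinear map `f`. -/
def extMap (σ : A →+* B) (f : M →ₛₗ[σ] N) : ExteriorAlgebra A M →+* ExteriorAlgebra B N :=
  extLift ((algebraMap B (ExteriorAlgebra B N)).comp σ) (fun a e => Algebra.commutes (σ a) e)
    ((ExteriorAlgebra.ι B).toAddMonoidHom.comp f.toAddMonoidHom)
    (fun a m => by simp [Algebra.smul_def])
    (fun m => ExteriorAlgebra.ι_sq_zero (R := B) (f m))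

theorem extMap_ι (σ : A →+* B) (f : M →ₛₗ[σ] N) (m : M) :
    extMap σ f (ExteriorAlgebra.ι A m) = ExteriorAlgebra.ι B (f m) :=
  extLift_ι _ _ _ _ _ m

theorem extMap_algebraMap (σ : A →+* B) (f : M →ₛₗ[σ] N) (a : A) :
    extMap σ f (algebraMap A _ a) = algebraMap B _ (σ a) :=
  extLift_algebraMap _ _ _ _ _ a

theorem extMap_smul (σ : A →+* B) (f : M →ₛₗ[σ] N) (a : A) (x : ExteriorAlgebra A M) :
    extMap σ f (a • x) = σ a • extMap σ f x := by
  rw [Algebra.smul_def, Algebra.smul_def, map_mul, extMap_algebraMap]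

end ExteriorMap

variable (V : Type*) [NormedAddCommGroup V] [InnerProductSpace ℂ V]

/-! ### Polynomial functions, derivations, differential forms -/

/-- The algebra `S` of polynomial functions on `V`: the symmetric algebra of the dual space. -/
def PolyFun : Type _ := SymmetricAlgebra ℂ (Dual ℂ V)

instance : CommRing (PolyFun V) := inferInstanceAs (CommRing (SymmetricAlgebra ℂ (Dual ℂ V)))

instance : Algebra ℂ (PolyFun V) := inferInstanceAs (Algebra ℂ (SymmetricAlgebra ℂ (Dual ℂ V)))

instance : IsDomain (PolyFun V) := inferInstanceAs (IsDomain (SymmetricAlgebra ℂ (Dual ℂ V)))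

/-- A linear form as a polynomial function. -/
def lin : Dual ℂ V →ₗ[ℂ] PolyFun V := SymmetricAlgebra.ι ℂ (Dual ℂ V)

/-- The module of `ℂ`-derivations of the algebra of polynomial functions. -/
abbrev Der : Type _ := Derivation ℂ (PolyFun V) (PolyFun V)

/-- The module `Ω¹` of polynomial differential `1`-forms: the dual of the module of derivations. -/
abbrev OneForm : Type _ := Der V →ₗ[PolyFun V] PolyFun V

/-- The exterior algebra `Ω` of `Ω¹` over `S`; its degree `p` part is
`Ωᵖ = ⋀[PolyFun V]^p (OneForm V)`. -/
abbrev Form : Type _ := ExteriorAlgebra (PolyFun V) (OneForm V)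

/-- The field of rational functions on `V`. -/
abbrev RatFun : Type _ := FractionRing (PolyFun V)

/-- Rational differential `1`-forms. -/
abbrev RatOneForm : Type _ := Der V →ₗ[PolyFun V] RatFun V

/-- The exterior algebra of rational differential forms. -/
abbrev RatForm : Type _ := ExteriorAlgebra (RatFun V) (RatOneForm V)

variable {V}

/-- Polynomial `1`-forms as rational `1`-forms. -/
def toRatOne : OneForm V →ₛₗ[algebraMap (PolyFun V) (RatFun V)] RatOneForm V where
  toFun ω := (Algebra.linearMap (PolyFun V) (RatFun V)).comp ω
  map_add' ω η := by ext θ; simp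
  map_smul' f ω := by
    ext θ
    simp [Algebra.smul_def]

/-- Polynomial differential forms as rational differential forms. -/
def toRat : Form V →+* RatForm V := extMap (algebraMap (PolyFun V) (RatFun V)) toRatOne

/-! ### The action of the general linear group -/

/-- The contragredient action of `g` on the dual space: `x ↦ x ∘ g⁻¹`. -/
def actDual (g : V ≃ₗ[ℂ] V) : Dual ℂ V →ₗ[ℂ] Dual ℂ V := ((g⁻¹ : V ≃ₗ[ℂ] V) : V →ₗ[ℂ] V).dualMap

/-- The action of `g` on polynomial functions: `(g f)(v) = f (g⁻¹ v)`. -/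
def actPoly (g : V ≃ₗ[ℂ] V) : PolyFun V →ₐ[ℂ] PolyFun V :=
  SymmetricAlgebra.lift (A := PolyFun V) ((lin V).comp (actDual g))

theorem actPoly_lin (g : V ≃ₗ[ℂ] V) (x : Dual ℂ V) :
    actPoly g (lin V x) = lin V (actDual g x) :=
  SymmetricAlgebra.lift_ι_apply (A := PolyFun V) ((lin V).comp (actDual g)) x

theorem polyFun_algHom_ext {F G : PolyFun V →ₐ[ℂ] PolyFun V}
    (h : ∀ x, F (lin V x) = G (lin V x)) : F = G :=
  SymmetricAlgebra.algHom_ext (A := PolyFun V) (LinearMap.ext h)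

theorem actPoly_mul (g h : V ≃ₗ[ℂ] V) (f : PolyFun V) :
    actPoly (g * h) f = actPoly g (actPoly h f) := by
  have : actPoly (g * h) = (actPoly g).comp (actPoly h) := by
    refine polyFun_algHom_ext fun x => ?_
    rw [AlgHom.comp_apply, actPoly_lin, actPoly_lin, actPoly_lin]
    refine congrArg (lin V) (LinearMap.ext fun v => ?_)
    simp [actDual, mul_inv_rev]
  rw [this]; rfl

theorem actPoly_one (f : PolyFun V) : actPoly (1 : V ≃ₗ[ℂ] V) f = f := by
  have : actPoly (1 : V ≃ₗ[ℂ] V) = AlgHom.id ℂ (PolyFun V) := by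
    refine polyFun_algHom_ext fun x => ?_
    rw [actPoly_lin]
    refine congrArg (lin V) (LinearMap.ext fun v => ?_)
    simp [actDual]
  rw [this]; rfl

theorem actPoly_cancel (g : V ≃ₗ[ℂ] V) (f : PolyFun V) : actPoly g (actPoly g⁻¹ f) = f := by
  rw [← actPoly_mul, mul_inv_cancel, actPoly_one]

/-- The action of `g` on derivations: `(g θ)(f) = g (θ (g⁻¹ f))`. -/
def actDer (g : V ≃ₗ[ℂ] V) : Der V →ₛₗ[(actPoly g : PolyFun V →+* PolyFun V)] Der V where
  toFun θ := Derivation.mk'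
    ((actPoly g).toLinearMap ∘ₗ (θ : PolyFun V →ₗ[ℂ] PolyFun V) ∘ₗ (actPoly g⁻¹).toLinearMap)
    (fun a b => by simp [actPoly_cancel])
  map_add' θ η := Derivation.ext fun f => map_add (actPoly g) _ _
  map_smul' a θ := Derivation.ext fun f => map_mul (actPoly g) _ _

theorem actDer_apply (g : V ≃ₗ[ℂ] V) (θ : Der V) (f : PolyFun V) :
    actDer g θ f = actPoly g (θ (actPoly g⁻¹ f)) := rfl

/-- The action of `g` on `1`-forms: `(g ω)(θ) = g (ω (g⁻¹ θ))`. -/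
def actOneForm (g : V ≃ₗ[ℂ] V) :
    OneForm V →ₛₗ[(actPoly g : PolyFun V →+* PolyFun V)] OneForm V where
  toFun ω :=
    { toFun := fun θ => actPoly g (ω (actDer g⁻¹ θ))
      map_add' := fun θ η => by simp
      map_smul' := fun f θ => by simp [actPoly_cancel] }
  map_add' ω η := by ext θ; simp
  map_smul' a ω := by ext θ; simp

/-- The action of `g` on differential forms:
`g (f · ω₁ ∧ ⋯ ∧ ωₚ) = g f · g ω₁ ∧ ⋯ ∧ g ωₚ`. -/
def actForm (g : V ≃ₗ[ℂ] V) : Form V →+* Form V :=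
  extMap (actPoly g : PolyFun V →+* PolyFun V) (actOneForm g)

/-! ### Unitary reflection groups -/

/-- The space of vectors fixed by `g`. -/
def fixedSpace (g : V ≃ₗ[ℂ] V) : Submodule ℂ V :=
  LinearMap.ker ((g : V →ₗ[ℂ] V) - LinearMap.id)

/-- `g` fixes pointwise a hyperplane, and nothing more. -/
def IsReflection (g : V ≃ₗ[ℂ] V) : Prop :=
  finrank ℂ (fixedSpace g) + 1 = finrank ℂ V

/-- `W` is a finite group of unitary transformations of `V` generated by reflections. -/
structure IsUnitaryReflectionGroup (W : Subgroup (V ≃ₗ[ℂ] V)) : Prop where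
  finite : Finite W
  unitary : ∀ w ∈ W, ∀ u v : V, inner ℂ (w u) (w v) = inner ℂ u v
  generated : Subgroup.closure {w | w ∈ W ∧ IsReflection w} = W

/-- The reflecting hyperplanes of `W`. -/
def hyperplanes (W : Subgroup (V ≃ₗ[ℂ] V)) : Set (Submodule ℂ V) :=
  {H | ∃ w ∈ W, IsReflection w ∧ fixedSpace w = H}

theorem hyperplanes_finite (W : Subgroup (V ≃ₗ[ℂ] V)) (hW : IsUnitaryReflectionGroup W) :
    (hyperplanes W).Finite := by
  have := hW.finite
  refine (Set.finite_range fun w : W => fixedSpace (w : V ≃ₗ[ℂ] V)).subset ?_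
  rintro H ⟨w, hw, -, rfl⟩
  exact ⟨⟨w, hw⟩, rfl⟩

/-- The product of the linear forms `α H` over all reflecting hyperplanes `H` of `W`
(there are finitely many of them when `W` is finite). -/
def definingPoly (W : Subgroup (V ≃ₗ[ℂ] V)) (α : Submodule ℂ V → Dual ℂ V) : PolyFun V :=
  ∏ᶠ H ∈ hyperplanes W, lin V (α H)

/-! ### Invariants and anti-invariants -/

/-- The ring `R` of polynomial functions invariant under `W`. -/
def invariantRing (W : Subgroup (V ≃ₗ[ℂ] V)) : Subalgebra ℂ (PolyFun V) where
  carrier := {f | ∀ w ∈ W, actPoly w f = f}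
  mul_mem' ha hb w hw := by rw [map_mul, ha w hw, hb w hw]
  add_mem' ha hb w hw := by rw [map_add, ha w hw, hb w hw]
  algebraMap_mem' c w _ := AlgHom.commutes _ c

/-- The `R`-module of derivations invariant under `W`. -/
def invDer (W : Subgroup (V ≃ₗ[ℂ] V)) : Submodule (invariantRing W) (Der V) where
  carrier := {θ | ∀ w ∈ W, actDer w θ = θ}
  add_mem' ha hb w hw := by rw [map_add, ha w hw, hb w hw]
  zero_mem' w _ := map_zero _
  smul_mem' r θ hθ w hw := by
    have h : r • θ = (r : PolyFun V) • θ := rfl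
    have hr : actPoly w (r : PolyFun V) = r := r.2 w hw
    rw [h, LinearMap.map_smulₛₗ, hθ w hw]
    simp [hr]

/-- The character `det⁻¹`. -/
def detInv (w : V ≃ₗ[ℂ] V) : ℂ := (LinearMap.det (w : V →ₗ[ℂ] V))⁻¹

/-- The `R`-module `(Ω¹)^{det⁻¹}` of anti-invariant `1`-forms. -/
def antiInvOne (W : Subgroup (V ≃ₗ[ℂ] V)) : Submodule (invariantRing W) (OneForm V) where
  carrier := {ω | ∀ w ∈ W, actOneForm w ω = detInv w • ω}
  add_mem' ha hb w hw := by rw [map_add, ha w hw, hb w hw, smul_add]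
  zero_mem' w _ := by rw [map_zero, smul_zero]
  smul_mem' r ω hω w hw := by
    have h : r • ω = (r : PolyFun V) • ω := rfl
    have hr : actPoly w (r : PolyFun V) = r := r.2 w hw
    rw [h, LinearMap.map_smulₛₗ, hω w hw, smul_comm]
    simp [hr]

/-- The `R`-module `(Ωᵖ)^{det⁻¹}` of anti-invariant `p`-forms. -/
def antiInv (W : Subgroup (V ≃ₗ[ℂ] V)) (p : ℕ) : Submodule (invariantRing W) (Form V) where
  carrier := {ω | ω ∈ ⋀[PolyFun V]^p (OneForm V) ∧ ∀ w ∈ W, actForm w ω = detInv w • ω}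
  add_mem' ha hb := ⟨add_mem ha.1 hb.1, fun w hw => by
    rw [map_add, ha.2 w hw, hb.2 w hw, smul_add]⟩
  zero_mem' := ⟨zero_mem _, fun w _ => by rw [map_zero, smul_zero]⟩
  smul_mem' r ω hω := by
    have h : r • ω = (r : PolyFun V) • ω := by
      rw [← algebraMap_smul (PolyFun V) r ω]; rfl
    rw [h]
    refine ⟨Submodule.smul_mem _ _ hω.1, fun w hw => ?_⟩
    have hr : actPoly w (r : PolyFun V) = r := r.2 w hw
    rw [actForm, extMap_smul]
    have := hω.2 w hw
    rw [actForm] at this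
    rw [this, smul_comm]
    simp [hr]

instance (W : Subgroup (V ≃ₗ[ℂ] V)) : Module (invariantRing W) (antiInvOne W) :=
  Submodule.module _

/-- Anti-invariant `1`-forms as rational `1`-forms. -/
def antiInvOneToRat (W : Subgroup (V ≃ₗ[ℂ] V)) :
    antiInvOne W →ₛₗ[algebraMap (invariantRing W) (RatFun V)] RatOneForm V where
  toFun ω := toRatOne ω.1
  map_add' ω η := map_add toRatOne ω.1 η.1
  map_smul' r ω := LinearMap.map_smulₛₗ toRatOne (r : PolyFun V) ω.1

/-- The natural map, `r · η₁ ∧ ⋯ ∧ ηₚ ↦ r · η₁ ∧ ⋯ ∧ ηₚ`, from the exterior algebra over `R` of the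
module of anti-invariant `1`-forms to the rational differential forms. -/
def wedge (W : Subgroup (V ≃ₗ[ℂ] V)) :
    ExteriorAlgebra (invariantRing W) (antiInvOne W) →+* RatForm V :=
  extMap (algebraMap (invariantRing W) (RatFun V)) (antiInvOneToRat W)

/-- The family `ω` of rational `1`-forms is dual to the family `θ` of derivations. -/
def IsDualFamily {ℓ : ℕ} (θ : Fin ℓ → Der V) (ω : Fin ℓ → RatOneForm V) : Prop :=
  ∀ i j, ω j (θ i) = if i = j then 1 else 0

end ReflForms

end

/-! Let θ_1, …, θ_ℓ be an R-basis of the invariant derivations, M the matrix of their coefficients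
in linear coordinates, and ω_j the dual rational forms. Everything rests on two facts: such a basis
exists, and det M is a nonzero constant times Q.

Existence. S is flat over R (`flat_polyFun`). Indeed, by induction on the degree, an element of the
kernel of I ⊗ S → S is killed by the operators f ↦ (f - s f)/α of the reflections s. It is therefore
fixed by W, and averaging moves it to I ⊗ R, where the kernel is zero. Averaging also makes the
invariant derivations an R-summand of Der_S, so they are flat over R, and a flat positively graded
module over a graded domain with constants ℂ in degree zero is free (`free_of_flat_of_graded`). The
rank is at most ℓ because invariant derivations independent over R are independent over S. It is at
least ℓ because averaged vector fields take arbitrary values at a point with trivial stabilizer.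

Determinant. det M transforms by det⁻¹, hence equals Q g for some polynomial g (`definingPoly_dvd`).
Suitable averaged fields show that det M does not vanish at a point with trivial stabilizer, and
that it vanishes only to first order at a point of a single hyperplane H whose stabilizer fixes H.
So g has no zero outside finitely many subspaces of codimension at least two, and is constant
(`exists_det_coeffMatrix_eq`).

Conclusion. The coordinates of a p-form in the basis ω_I are its values on the θ_I. For an
anti-invariant polynomial form these are polynomials transforming by det⁻¹, that is, elements of R
Q. Conversely Q ω_I is polynomial, since det M times a minor of M⁻¹ is a polynomial
(`det_mul_minor`), and it is anti-invariant because its values on the θ_J are Q or 0. So the Q ω_I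
form an R-basis of the anti-invariant p-forms. The p-th exterior power of the basis Q ω_j of the
case p = 1 consists of the Q^p ω_I, and the factor Q^(1-p) makes the two bases coincide. -/

noncomputable section

namespace ReflForms

variable {V : Type*} [NormedAddCommGroup V] [InnerProductSpace ℂ V]

/-! ### Homomorphisms out of the algebra of polynomial functions -/

section Hom

variable {A : Type*} [CommRing A] [Algebra ℂ A]

/-- The algebra homomorphism out of the polynomial functions with given values on linear forms. -/
def polyLift (f : Dual ℂ V →ₗ[ℂ] A) : PolyFun V →ₐ[ℂ] A :=
  SymmetricAlgebra.lift (A := A) f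

@[simp]
theorem polyLift_lin (f : Dual ℂ V →ₗ[ℂ] A) (x : Dual ℂ V) : polyLift f (lin V x) = f x :=
  SymmetricAlgebra.lift_ι_apply (A := A) f x

theorem polyFun_hom_ext {F G : PolyFun V →ₐ[ℂ] A} (h : ∀ x, F (lin V x) = G (lin V x)) : F = G :=
  SymmetricAlgebra.algHom_ext (A := A) (LinearMap.ext h)

theorem polyFun_hom_congr {F G : PolyFun V →ₐ[ℂ] A} (h : ∀ x, F (lin V x) = G (lin V x))
    (f : PolyFun V) : F f = G f := by
  rw [polyFun_hom_ext h]

end Hom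

/-- The value of a polynomial function at a vector. -/
def evalAt (v : V) : PolyFun V →ₐ[ℂ] ℂ := polyLift (Dual.eval ℂ V v)

@[simp]
theorem evalAt_lin (v : V) (x : Dual ℂ V) : evalAt v (lin V x) = x v := by
  simp [evalAt]

theorem actDual_apply (g : V ≃ₗ[ℂ] V) (x : Dual ℂ V) (v : V) : actDual g x v = x (g⁻¹ v) := rfl

theorem evalAt_actPoly (g : V ≃ₗ[ℂ] V) (v : V) (f : PolyFun V) :
    evalAt v (actPoly g f) = evalAt (g⁻¹ v) f :=
  polyFun_hom_congr (F := (evalAt v).comp (actPoly g)) (G := evalAt (g⁻¹ v))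
    (fun x => by simp [actPoly_lin, actDual_apply]) f

/-- In coordinates S is a polynomial ring over the infinite field ℂ, where a polynomial vanishing at
every point is zero. -/
theorem eq_zero_of_evalAt [FiniteDimensional ℂ V] {f : PolyFun V} (h : ∀ v, evalAt v f = 0) :
    f = 0 := by
  let e := Module.finBasis ℂ V
  let E : PolyFun V ≃ₐ[ℂ] MvPolynomial (Fin (finrank ℂ V)) ℂ :=
    SymmetricAlgebra.equivMvPolynomial e.dualBasis
  have hE : ∀ j, E (lin V (e.dualBasis j)) = MvPolynomial.X j := fun j =>
    SymmetricAlgebra.equivMvPolynomial_ι_apply e.dualBasis j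
  have key : ∀ c : Fin (finrank ℂ V) → ℂ,
      MvPolynomial.eval c (E f) = evalAt (∑ i, c i • e i) f := by
    intro c
    have hlin : ((MvPolynomial.aeval (R := ℂ) c).comp (E : PolyFun V →ₐ[ℂ] _)).toLinearMap ∘ₗ lin V
        = Dual.eval ℂ V (∑ i, c i • e i) := by
      refine e.dualBasis.ext fun j => ?_
      have := congrArg (MvPolynomial.eval c) (hE j)
      simpa [Finsupp.single_apply] using this
    have := polyFun_hom_congr
      (F := (MvPolynomial.aeval (R := ℂ) c).comp (E : PolyFun V →ₐ[ℂ] _))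
      (G := evalAt (∑ i, c i • e i)) (fun x => by
        rw [evalAt_lin]
        exact LinearMap.congr_fun hlin x) f
    exact this
  have h0 : E f = 0 := MvPolynomial.funext fun c => by
    rw [key, h]
    exact (map_zero (MvPolynomial.eval c)).symm
  exact (EmbeddingLike.map_eq_zero_iff (f := E)).1 h0

theorem eq_of_evalAt [FiniteDimensional ℂ V] {f g : PolyFun V}
    (h : ∀ v, evalAt v f = evalAt v g) : f = g :=
  sub_eq_zero.1 (eq_zero_of_evalAt fun v => by rw [map_sub, h, sub_self])

theorem exists_evalAt_ne_zero [FiniteDimensional ℂ V] {f : PolyFun V} (h : f ≠ 0) :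
    ∃ v, evalAt v f ≠ 0 := by
  by_contra! H
  exact h (eq_zero_of_evalAt H)

theorem lin_ne_zero {x : Dual ℂ V} (hx : x ≠ 0) : lin V x ≠ 0 := by
  intro h
  refine hx (LinearMap.ext fun v => ?_)
  rw [← evalAt_lin, h, map_zero, LinearMap.zero_apply]

/-! ### The grading -/

/-- The coaction of the multiplicative group, `x ↦ x · t` for linear forms `x`. -/
def scale : PolyFun V →ₐ[ℂ] Polynomial (PolyFun V) :=
  polyLift (((LinearMap.mulLeft ℂ (Polynomial.X : Polynomial (PolyFun V))) ∘ₗ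
    (Polynomial.CAlgHom (R := ℂ) (A := PolyFun V)).toLinearMap) ∘ₗ lin V)

@[simp]
theorem scale_lin (x : Dual ℂ V) :
    scale (lin V x) = Polynomial.X * Polynomial.C (lin V x) := by
  simp [scale]

/-- The homogeneous component of degree `n` of a polynomial function. -/
def comp (n : ℕ) : PolyFun V →ₗ[ℂ] PolyFun V :=
  ((Polynomial.lcoeff (PolyFun V) n).restrictScalars ℂ) ∘ₗ scale.toLinearMap

theorem comp_apply (n : ℕ) (f : PolyFun V) : comp n f = (scale f).coeff n := rfl

theorem comp_mul (n : ℕ) (f g : PolyFun V) :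
    comp n (f * g) = ∑ ij ∈ Finset.HasAntidiagonal.antidiagonal n, comp ij.1 f * comp ij.2 g := by
  simp only [comp_apply, map_mul, Polynomial.coeff_mul]

theorem comp_lin_mul (n : ℕ) (x : Dual ℂ V) (f : PolyFun V) :
    comp (n + 1) (lin V x * f) = lin V x * comp n f := by
  rw [comp_apply, map_mul, scale_lin, mul_assoc, Polynomial.coeff_X_mul, Polynomial.coeff_C_mul,
    comp_apply]

theorem scale_eval_one (f : PolyFun V) : (scale f).eval 1 = f := by
  have := polyFun_hom_congr
    (F := ((Polynomial.aeval (R := PolyFun V) (1 : PolyFun V)).restrictScalars ℂ).comp scale)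
    (G := AlgHom.id ℂ _) (fun x => by simp) f
  simpa [Polynomial.aeval_def, Polynomial.eval₂_id] using this

theorem sum_comp (f : PolyFun V) {N : ℕ} (h : (scale f).natDegree < N) :
    ∑ n ∈ Finset.range N, comp n f = f := by
  conv_rhs => rw [← scale_eval_one f, Polynomial.eval_eq_sum_range' h]
  simp [comp_apply]

/-- Scaling by t and then by s is scaling by ts: both sides are algebra homomorphisms, so this needs
checking only on linear forms. Comparing coefficients gives the orthogonality of the projections. -/
theorem comp_comp (m n : ℕ) (f : PolyFun V) :
    comp m (comp n f) = if m = n then comp n f else 0 := by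
  let T : Polynomial (PolyFun V) →ₐ[PolyFun V] Polynomial (Polynomial (PolyFun V)) :=
    Polynomial.aeval (Polynomial.C Polynomial.X * Polynomial.X)
  have h1 : ∀ p : Polynomial (PolyFun V),
      (T p).coeff n = Polynomial.C (p.coeff n) * Polynomial.X ^ n := by
    intro p
    induction p using Polynomial.induction_on' with
    | add p q hp hq => simp [hp, hq, add_mul]
    | monomial k a =>
      simp only [T, Polynomial.aeval_monomial, mul_pow, ← Polynomial.C_pow]
      rw [IsScalarTower.algebraMap_apply (PolyFun V) (Polynomial (PolyFun V))
        (Polynomial (Polynomial (PolyFun V))), Polynomial.algebraMap_eq, Polynomial.algebraMap_eq,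
        ← mul_assoc, ← Polynomial.C_mul, Polynomial.coeff_C_mul_X_pow, Polynomial.coeff_monomial]
      by_cases h : n = k
      · simp [h]
      · simp [h, Ne.symm h]
  have h2 : ∀ f, Polynomial.mapAlgHom (scale (V := V)) (scale f) = T (scale f) :=
    polyFun_hom_congr (F := (Polynomial.mapAlgHom (scale (V := V))).comp scale)
      (G := (T.restrictScalars ℂ).comp scale) (fun x => by
        change Polynomial.map _ (scale (lin V x)) = T (scale (lin V x))
        rw [scale_lin, Polynomial.map_mul, Polynomial.map_X, Polynomial.map_C, map_mul]
        have : T (Polynomial.C (lin V x)) = Polynomial.C (Polynomial.C (lin V x)) := by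
          simp only [T, Polynomial.aeval_C]
          rfl
        rw [this]
        simp only [T, Polynomial.aeval_X]
        change Polynomial.X * Polynomial.C (scale (lin V x)) = _
        rw [scale_lin, Polynomial.C_mul, ← mul_assoc, mul_comm Polynomial.X])
  have h3 := congrArg (fun p => (p.coeff n).coeff m) (h2 f)
  simp only [h1, Polynomial.coe_mapAlgHom, Polynomial.coeff_map, Polynomial.coeff_C_mul_X_pow] at h3
  exact h3

/-- Putting t = 0 in `scale` sends every linear form to zero, as evaluation at the origin does. -/
theorem comp_zero (f : PolyFun V) : comp 0 f = algebraMap ℂ _ (evalAt 0 f) := by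
  have := polyFun_hom_congr
    (F := ((Polynomial.aeval (R := PolyFun V) (0 : PolyFun V)).restrictScalars ℂ).comp scale)
    (G := (Algebra.ofId ℂ (PolyFun V)).comp (evalAt 0)) (fun x => by simp) f
  rw [comp_apply, Polynomial.coeff_zero_eq_eval_zero]
  simpa [Polynomial.aeval_def, Polynomial.eval₂_id, Algebra.ofId_apply] using this

theorem comp_actPoly (n : ℕ) (g : V ≃ₗ[ℂ] V) (f : PolyFun V) :
    comp n (actPoly g f) = actPoly g (comp n f) := by
  have := polyFun_hom_congr (F := scale.comp (actPoly g))
    (G := (Polynomial.mapAlgHom (actPoly g)).comp scale) (fun x => by simp [actPoly_lin]) f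
  have h := congrArg (fun p => p.coeff n) this
  simpa [comp_apply] using h

/-- The components of `f` of degree at least `n` vanish. -/
def IsBelow (n : ℕ) (f : PolyFun V) : Prop := ∀ k, n ≤ k → comp k f = 0

theorem isBelow_natDegree (f : PolyFun V) : IsBelow ((scale f).natDegree + 1) f := fun _ hk =>
  Polynomial.coeff_eq_zero_of_natDegree_lt hk

theorem IsBelow.eq_zero {f : PolyFun V} (h : IsBelow 0 f) : f = 0 := by
  rw [← sum_comp f (Nat.lt_succ_self _)]
  exact Finset.sum_eq_zero fun k _ => h k (Nat.zero_le k)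

theorem IsBelow.mono {m n : ℕ} (hmn : m ≤ n) {f : PolyFun V} (h : IsBelow m f) : IsBelow n f :=
  fun k hk => h k (hmn.trans hk)

/-! ### Divisibility by linear forms -/

theorem eq_smul_of_ker_le {α x : Dual ℂ V} {e : V} (he : α e = 1)
    (h : LinearMap.ker α ≤ LinearMap.ker x) : x = x e • α := by
  ext v
  have : v - α v • e ∈ LinearMap.ker x := h (by simp [he])
  rw [LinearMap.mem_ker, map_sub, map_smul, sub_eq_zero] at this
  simp [this, mul_comm]

theorem exists_apply_eq_one {α : Dual ℂ V} (hα : α ≠ 0) : ∃ e, α e = 1 := by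
  obtain ⟨v, hv⟩ : ∃ v, α v ≠ 0 := by
    by_contra! H
    exact hα (LinearMap.ext H)
  exact ⟨(α v)⁻¹ • v, by simp [hv]⟩

/-- Restriction of polynomial functions to `ker α`, as a retraction of the algebra. -/
def restrictKer (α : Dual ℂ V) (e : V) : PolyFun V →ₐ[ℂ] PolyFun V :=
  polyLift (lin V ∘ₗ (LinearMap.id - (Dual.eval ℂ V e).smulRight α))

theorem restrictKer_lin (α : Dual ℂ V) (e : V) (x : Dual ℂ V) :
    restrictKer α e (lin V x) = lin V (x - x e • α) := by
  simp [restrictKer]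

/-- Modulo the ideal generated by α the two homomorphisms agree on generators, hence everywhere. -/
theorem dvd_sub_of_lin {α : PolyFun V} {F G : PolyFun V →ₐ[ℂ] PolyFun V}
    (h : ∀ x, α ∣ F (lin V x) - G (lin V x)) (f : PolyFun V) : α ∣ F f - G f := by
  have := polyFun_hom_congr (F := (Ideal.Quotient.mkₐ ℂ (Ideal.span {α})).comp F)
    (G := (Ideal.Quotient.mkₐ ℂ (Ideal.span {α})).comp G) (fun x => by
      simpa [Ideal.Quotient.eq, Ideal.mem_span_singleton] using h x) f
  simpa [Ideal.Quotient.eq, Ideal.mem_span_singleton] using this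

/-- `restrictKer` kills α and changes each linear form by a multiple of α, so f is congruent to its
restriction modulo α. -/
theorem lin_dvd_iff {α : Dual ℂ V} {e : V} (he : α e = 1) (f : PolyFun V) :
    lin V α ∣ f ↔ restrictKer α e f = 0 := by
  constructor
  · rintro ⟨g, rfl⟩
    rw [map_mul, restrictKer_lin, he]
    simp
  · intro h
    have := dvd_sub_of_lin (α := lin V α) (F := AlgHom.id ℂ _) (G := restrictKer α e)
      (fun x => ⟨algebraMap ℂ _ (x e), by
        rw [restrictKer_lin]
        simp [Algebra.smul_def, mul_comm]⟩) f
    simpa [h] using this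

/-- The multiples of α are the kernel of a homomorphism into a domain. -/
theorem prime_lin {α : Dual ℂ V} (hα : α ≠ 0) : Prime (lin V α) := by
  obtain ⟨e, he⟩ := exists_apply_eq_one hα
  refine ⟨lin_ne_zero hα, fun hu => ?_, fun a b h => ?_⟩
  · have := hu.map (restrictKer α e)
    rw [(lin_dvd_iff he _).1 dvd_rfl] at this
    exact not_isUnit_zero this
  · rw [lin_dvd_iff he, map_mul, mul_eq_zero] at h
    rwa [lin_dvd_iff he, lin_dvd_iff he]

theorem ker_le_of_lin_dvd_lin {α β : Dual ℂ V} (h : lin V α ∣ lin V β) :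
    LinearMap.ker α ≤ LinearMap.ker β := by
  obtain ⟨g, hg⟩ := h
  intro v hv
  rw [LinearMap.mem_ker] at hv ⊢
  rw [← evalAt_lin, hg, map_mul, evalAt_lin, hv, zero_mul]

/-! ### Reflections -/

theorem mem_fixedSpace {g : V ≃ₗ[ℂ] V} {v : V} : v ∈ fixedSpace g ↔ g v = v := by
  simp [fixedSpace, sub_eq_zero]

theorem fixedSpace_inv (g : V ≃ₗ[ℂ] V) : fixedSpace g⁻¹ = fixedSpace g := by
  ext v
  rw [mem_fixedSpace, mem_fixedSpace]
  change g.symm v = v ↔ _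
  rw [LinearEquiv.symm_apply_eq, eq_comm]

theorem IsReflection.fixedSpace_ne_top [FiniteDimensional ℂ V] {g : V ≃ₗ[ℂ] V}
    (hg : IsReflection g) : fixedSpace g ≠ ⊤ := by
  intro h
  rw [IsReflection, h, finrank_top] at hg
  omega

theorem apply_eq_add {g : V ≃ₗ[ℂ] V} {α : Dual ℂ V} {e : V} (he : α e = 1)
    (hg : LinearMap.ker α ≤ fixedSpace g) (v : V) : g v = v + α v • (g e - e) := by
  have : v - α v • e ∈ fixedSpace g := hg (by simp [he])
  rw [mem_fixedSpace, map_sub, map_smul] at this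
  rw [smul_sub, sub_eq_sub_iff_add_eq_add.1 this |> eq_sub_of_add_eq]
  abel

/-- Here g is v ↦ v + α v • u with u = g e - e, and the determinant of such a map is 1 + α u. -/
theorem det_eq_of_ker_le [FiniteDimensional ℂ V] {g : V ≃ₗ[ℂ] V} {α : Dual ℂ V} {e : V}
    (he : α e = 1) (hg : LinearMap.ker α ≤ fixedSpace g) :
    LinearMap.det (g : V →ₗ[ℂ] V) = α (g e) := by
  have : (g : V →ₗ[ℂ] V) = LinearMap.transvection α (g e - e) := by
    ext v
    simpa [LinearMap.transvection.apply] using apply_eq_add he hg v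
  rw [this, LinearMap.transvection.det, map_sub, he]
  ring

theorem dual_apply_of_ker_le [FiniteDimensional ℂ V] {g : V ≃ₗ[ℂ] V} {α : Dual ℂ V}
    (hα : α ≠ 0) (hg : LinearMap.ker α ≤ fixedSpace g) (v : V) :
    α (g v) = LinearMap.det (g : V →ₗ[ℂ] V) * α v := by
  obtain ⟨e, he⟩ := exists_apply_eq_one hα
  rw [det_eq_of_ker_le he hg, apply_eq_add he hg v]
  simp [he]
  ring

theorem det_inv_eq (g : V ≃ₗ[ℂ] V) :
    LinearMap.det ((g⁻¹ : V ≃ₗ[ℂ] V) : V →ₗ[ℂ] V) = detInv g := by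
  have : LinearMap.det ((g⁻¹ : V ≃ₗ[ℂ] V) : V →ₗ[ℂ] V) * LinearMap.det (g : V →ₗ[ℂ] V) = 1 := by
    have h : ((g⁻¹ : V ≃ₗ[ℂ] V) : V →ₗ[ℂ] V) * (g : V →ₗ[ℂ] V) = 1 :=
      LinearMap.ext fun v => g.symm_apply_apply v
    rw [← map_mul, h, map_one]
  rw [detInv, eq_inv_of_mul_eq_one_left this]

theorem detInv_mul (g : V ≃ₗ[ℂ] V) : detInv g * LinearMap.det (g : V →ₗ[ℂ] V) = 1 := by
  rw [detInv, inv_mul_cancel₀]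
  exact (LinearEquiv.isUnit_det' g).ne_zero

theorem detInv_ne_zero (g : V ≃ₗ[ℂ] V) : detInv g ≠ 0 := left_ne_zero_of_mul_eq_one (detInv_mul g)

theorem actDual_of_ker_le [FiniteDimensional ℂ V] {g : V ≃ₗ[ℂ] V} {α : Dual ℂ V}
    (hα : α ≠ 0) (hg : LinearMap.ker α ≤ fixedSpace g) : actDual g α = detInv g • α := by
  ext v
  rw [actDual_apply, dual_apply_of_ker_le hα (by rwa [fixedSpace_inv]), det_inv_eq]
  rfl

/-- A reflection of determinant one would be g e = e + u with u in the fixed hyperplane, so that g ^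
n e = e + n u; finite order forces u = 0, and g would fix e. -/
theorem detInv_ne_one [FiniteDimensional ℂ V] {g : V ≃ₗ[ℂ] V} (hg : IsReflection g)
    (hfin : IsOfFinOrder g) {α : Dual ℂ V} (hα : LinearMap.ker α = fixedSpace g) :
    detInv g ≠ 1 := by
  have hα0 : α ≠ 0 := by
    rintro rfl
    exact hg.fixedSpace_ne_top (by rw [← hα, LinearMap.ker_zero])
  obtain ⟨e, he⟩ := exists_apply_eq_one hα0
  intro h
  rw [detInv, inv_eq_one, det_eq_of_ker_le he hα.le] at h
  have hu : g (g e - e) = g e - e := by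
    rw [← mem_fixedSpace, ← hα, LinearMap.mem_ker, map_sub, h, he, sub_self]
  have hpow : ∀ n : ℕ, (g ^ n) e = e + n • (g e - e) := by
    intro n
    induction n with
    | zero => simp
    | succ n ih =>
      rw [pow_succ', LinearEquiv.mul_apply, ih, map_add, map_nsmul, hu, succ_nsmul]
      abel
  obtain ⟨n, hn, hgn⟩ := isOfFinOrder_iff_pow_eq_one.1 hfin
  have h1 := hpow n
  rw [hgn, LinearEquiv.coe_one, id_eq, left_eq_add] at h1
  have h2 : g e - e = 0 := by
    rw [← Nat.cast_smul_eq_nsmul ℂ] at h1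
    exact (smul_eq_zero.1 h1).resolve_left (Nat.cast_ne_zero.2 hn.ne')
  have h3 : e ∈ LinearMap.ker α := by
    rw [hα, mem_fixedSpace, sub_eq_zero.1 h2]
  rw [LinearMap.mem_ker, he] at h3
  exact one_ne_zero h3

/-- For a linear form x the difference x - g x vanishes on the hyperplane, hence is a multiple of α;
the general case follows from generators. -/
theorem lin_dvd_sub_actPoly {g : V ≃ₗ[ℂ] V} {α : Dual ℂ V} (hα : α ≠ 0)
    (hg : LinearMap.ker α ≤ fixedSpace g) (f : PolyFun V) : lin V α ∣ f - actPoly g f := by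
  obtain ⟨e, he⟩ := exists_apply_eq_one hα
  refine dvd_sub_of_lin (F := AlgHom.id ℂ _) (G := actPoly g) (fun x => ?_) f
  have : x - actDual g x = (x - actDual g x) e • α := by
    refine eq_smul_of_ker_le he fun v hv => ?_
    have h : g⁻¹ v = v := mem_fixedSpace.1 (by rw [fixedSpace_inv]; exact hg hv)
    simp [actDual_apply, h]
  rw [AlgHom.id_apply, actPoly_lin, ← map_sub, this, map_smul]
  exact Dvd.intro_left _ (Algebra.smul_def _ _).symm

/-- α divides f - g f, which is (1 - det⁻¹) f, and the scalar is nonzero. -/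
theorem lin_dvd_of_semiinvariant [FiniteDimensional ℂ V] {g : V ≃ₗ[ℂ] V} (hg : IsReflection g)
    (hfin : IsOfFinOrder g) {α : Dual ℂ V} (hα : LinearMap.ker α = fixedSpace g) {f : PolyFun V}
    (hf : actPoly g f = detInv g • f) : lin V α ∣ f := by
  have hα0 : α ≠ 0 := by
    rintro rfl
    exact hg.fixedSpace_ne_top (by rw [← hα, LinearMap.ker_zero])
  have h := lin_dvd_sub_actPoly hα0 hα.le f
  have hne : 1 - detInv g ≠ 0 := sub_ne_zero.2 (detInv_ne_one hg hfin hα).symm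
  have h2 : f = (1 - detInv g)⁻¹ • (f - actPoly g f) := by
    rw [hf, eq_inv_smul_iff₀ hne, sub_smul, one_smul]
  rw [h2, Algebra.smul_def]
  exact h.mul_left _

end ReflForms
end

/-! ### Flatness of the polynomial functions over the invariants -/

noncomputable section

namespace ReflForms

variable {V : Type*} [NormedAddCommGroup V] [InnerProductSpace ℂ V]

/-! ### Invariants of a unitary reflection group -/

theorem IsUnitaryReflectionGroup.isOfFinOrder {W : Subgroup (V ≃ₗ[ℂ] V)}
    (hW : IsUnitaryReflectionGroup W) {w : V ≃ₗ[ℂ] V} (hw : w ∈ W) : IsOfFinOrder w := by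
  have := hW.finite
  have h : IsOfFinOrder (⟨w, hw⟩ : W) := isOfFinOrder_of_finite _
  exact MonoidHom.isOfFinOrder W.subtype h

/-- To prove a property stable under products and inverses for all elements of a reflection group
it suffices to consider reflections. -/
theorem IsUnitaryReflectionGroup.induction {W : Subgroup (V ≃ₗ[ℂ] V)}
    (hW : IsUnitaryReflectionGroup W) {P : W → Prop} (hone : P 1)
    (hrefl : ∀ w : W, IsReflection (w : V ≃ₗ[ℂ] V) → P w)
    (hmul : ∀ a b, P a → P b → P (a * b)) (hinv : ∀ a, P a → P a⁻¹) (w : W) : P w := by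
  have key : ∀ g ∈ Subgroup.closure {w | w ∈ W ∧ IsReflection w}, ∃ hg : g ∈ W, P ⟨g, hg⟩ := by
    intro g hg
    induction hg using Subgroup.closure_induction with
    | mem x hx => exact ⟨hx.1, hrefl ⟨x, hx.1⟩ hx.2⟩
    | one => exact ⟨W.one_mem, hone⟩
    | mul x y _ _ hx hy =>
      obtain ⟨hx, h1⟩ := hx
      obtain ⟨hy, h2⟩ := hy
      exact ⟨W.mul_mem hx hy, hmul _ _ h1 h2⟩
    | inv x _ hx =>
      obtain ⟨hx, h1⟩ := hx
      exact ⟨W.inv_mem hx, hinv _ h1⟩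
  obtain ⟨_, h⟩ := key w (hW.generated.symm ▸ w.2)
  exact h

variable (W : Subgroup (V ≃ₗ[ℂ] V))

theorem invariantRing_smul_def (r : invariantRing W) (f : PolyFun V) :
    r • f = (r : PolyFun V) * f :=
  rfl

/-- The action of an element of `W` as a linear map over the invariants. -/
def actInv (w : W) : PolyFun V →ₗ[invariantRing W] PolyFun V where
  toFun := actPoly (w : V ≃ₗ[ℂ] V)
  map_add' := map_add _
  map_smul' r f := by
    rw [invariantRing_smul_def, map_mul, r.2 w w.2]
    rfl

theorem actInv_apply (w : W) (f : PolyFun V) : actInv W w f = actPoly (w : V ≃ₗ[ℂ] V) f := rfl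

theorem actInv_mul (a b : W) : actInv W (a * b) = actInv W a ∘ₗ actInv W b :=
  LinearMap.ext fun f => actPoly_mul (a : V ≃ₗ[ℂ] V) b f

theorem actInv_one : actInv W 1 = LinearMap.id := LinearMap.ext fun f => actPoly_one f

/-- The operator `f ↦ (f - w f) / α` attached to a reflection `w` with hyperplane `ker α`. -/
theorem exists_demazure [FiniteDimensional ℂ V] (w : W) (hw : IsReflection (w : V ≃ₗ[ℂ] V)) :
    ∃ (a : PolyFun V) (d : PolyFun V →ₗ[invariantRing W] PolyFun V),
      (∀ f, f - actPoly (w : V ≃ₗ[ℂ] V) f = a * d f) ∧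
      ∀ n f, IsBelow (n + 1) f → IsBelow n (d f) := by
  obtain ⟨α, hα⟩ : ∃ α : Dual ℂ V, LinearMap.ker α = fixedSpace (w : V ≃ₗ[ℂ] V) := by
    obtain ⟨v, hv⟩ : ∃ v, v ∉ fixedSpace (w : V ≃ₗ[ℂ] V) := by
      by_contra! H
      exact hw.fixedSpace_ne_top (eq_top_iff.2 fun v _ => H v)
    obtain ⟨α, hαv, hα⟩ := Submodule.exists_le_ker_of_notMem hv
    refine ⟨α, (Submodule.eq_of_le_of_finrank_le hα ?_).symm⟩
    have h1 := LinearMap.finrank_range_add_finrank_ker α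
    have h2 : LinearMap.range α = ⊤ := by
      rw [LinearMap.range_eq_top]
      refine LinearMap.surjective_of_ne_zero ?_
      rintro rfl
      exact hαv rfl
    rw [h2, finrank_top, finrank_self] at h1
    rw [IsReflection] at hw
    omega
  have hα0 : α ≠ 0 := by
    rintro rfl
    exact hw.fixedSpace_ne_top (by rw [← hα, LinearMap.ker_zero])
  have ha := lin_ne_zero hα0
  choose d hd using lin_dvd_sub_actPoly hα0 hα.le
  -- S is a domain, so each property of the quotient d is checked after multiplication by α.
  refine ⟨lin V α, ⟨⟨d, fun f g => ?_⟩, fun r f => ?_⟩, hd, fun n f hf k hk => ?_⟩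
  · apply mul_left_cancel₀ ha
    rw [← hd, mul_add, ← hd, ← hd, map_add]
    ring
  · apply mul_left_cancel₀ ha
    change lin V α * d (r • f) = lin V α * (r • d f)
    rw [← hd, mul_smul_comm, ← hd, smul_sub]
    exact congrArg _ ((actInv W w).map_smul r f)
  · apply mul_left_cancel₀ ha
    change lin V α * comp k (d f) = _
    rw [mul_zero, ← comp_lin_mul, ← hd, map_sub, comp_actPoly, hf (k + 1) (by omega), map_zero,
      sub_zero]

/-- The order of `W` is invertible among the invariants. -/
theorem inv_card_mul_card (hW : IsUnitaryReflectionGroup W) :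
    (algebraMap ℂ (invariantRing W) (Nat.card W : ℂ)⁻¹) * (Nat.card W : invariantRing W) = 1 := by
  have := hW.finite
  have h : (Nat.card W : ℂ) ≠ 0 := Nat.cast_ne_zero.2 Nat.card_pos.ne'
  rw [← map_natCast (algebraMap ℂ (invariantRing W)), ← map_mul, inv_mul_cancel₀ h, map_one]

theorem sum_act_mem [Fintype W] (f : PolyFun V) :
    ∑ w : W, actPoly (w : V ≃ₗ[ℂ] V) f ∈ invariantRing W := by
  intro g hg
  rw [map_sum]
  refine Fintype.sum_equiv (Equiv.mulLeft (⟨g, hg⟩ : W)) _ _ fun w => ?_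
  rw [← actPoly_mul]
  rfl

/-- The sum over the group, as a linear map to the invariants. -/
def transfer [Fintype W] : PolyFun V →ₗ[invariantRing W] invariantRing W where
  toFun f := ⟨∑ w : W, actPoly (w : V ≃ₗ[ℂ] V) f, sum_act_mem W f⟩
  map_add' f g := Subtype.ext (by simp [Finset.sum_add_distrib])
  map_smul' r f := Subtype.ext (by
    change ∑ w : W, actInv W w (r • f) = (r : PolyFun V) * ∑ w : W, actInv W w f
    simp only [map_smul, Finset.mul_sum]
    rfl)

theorem subtype_comp_transfer [Fintype W] :
    Algebra.linearMap (invariantRing W) (PolyFun V) ∘ₗ transfer W = ∑ w : W, actInv W w := by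
  ext f
  simp only [LinearMap.coe_sum, Finset.sum_apply, actInv_apply]
  rfl

/-! ### Relations in the tensor product with an ideal -/

section Tensor

open TensorProduct

variable {R M N : Type*} [CommRing R] [AddCommGroup M] [Module R M] [AddCommGroup N] [Module R N]

theorem rTensor_lTensor_eq_zero (I : Ideal R) (d : M →ₗ[R] N) {x : I ⊗[R] M}
    (hx : I.subtype.rTensor M x = 0) : I.subtype.rTensor N (d.lTensor I x) = 0 := by
  have := LinearMap.congr_fun ((LinearMap.rTensor_comp_lTensor (f := I.subtype)
    (g := d)).trans (LinearMap.lTensor_comp_rTensor (f := I.subtype) (g := d)).symm) x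
  rw [LinearMap.comp_apply, LinearMap.comp_apply, hx, map_zero] at this
  exact this

/-- Relations fixed by a finite group whose transfer has values in the base ring are trivial. -/
theorem eq_zero_of_lTensor_fixed {G : Type*} [Fintype G] (I : Ideal R) (a : G → M →ₗ[R] M)
    (t : M →ₗ[R] R) (j : R →ₗ[R] M) (h : j ∘ₗ t = ∑ g, a g) (c : R)
    (hc : c * (Fintype.card G : R) = 1) {x : I ⊗[R] M} (hfix : ∀ g, (a g).lTensor I x = x)
    (hx : I.subtype.rTensor M x = 0) : x = 0 := by
  -- I ⊗ R → R is injective, so the transfer of a relation vanishes. Carried back to I ⊗ M by j, the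
  -- transfer of the fixed element x is |G| x.
  have hy : t.lTensor I x = 0 := by
    have hinj := Module.Flat.iff_rTensor_injective'.1 (inferInstance : Module.Flat R R) I
    exact (injective_iff_map_eq_zero _).1 hinj _ (rTensor_lTensor_eq_zero I t hx)
  have hsum : (Fintype.card G : R) • x = 0 := by
    have h' := congrArg (LinearMap.lTensor I j) hy
    rw [← LinearMap.comp_apply, ← LinearMap.lTensor_comp, h, map_zero,
      ← LinearMap.coe_lTensorHom, map_sum, LinearMap.sum_apply] at h'
    simp only [LinearMap.coe_lTensorHom, hfix, Finset.sum_const, Finset.card_univ] at h'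
    rwa [Nat.cast_smul_eq_nsmul]
  rw [← one_smul R x, ← hc, mul_smul, hsum, smul_zero]

end Tensor

open TensorProduct in
/-- The algebra of polynomial functions is flat over the invariants of a reflection group. -/
theorem flat_polyFun [FiniteDimensional ℂ V] (hW : IsUnitaryReflectionGroup W) :
    Module.Flat (invariantRing W) (PolyFun V) := by
  have := hW.finite
  have := Fintype.ofFinite W
  rw [Module.Flat.iff_rTensor_injective']
  intro I
  rw [injective_iff_map_eq_zero]
  -- The induction runs over this filtration by the degree of the second factor. It is exhaustive,
  -- and its zeroth step is trivial since only the zero function has no components.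
  let G : ℕ → AddSubgroup (I ⊗[invariantRing W] PolyFun V) := fun n =>
    AddSubgroup.closure {x | ∃ (i : I) (g : PolyFun V), IsBelow n g ∧ x = i ⊗ₜ g}
  have hG : ∀ x : I ⊗[invariantRing W] PolyFun V, ∃ n, x ∈ G n := by
    have hmono : ∀ {m n}, m ≤ n → G m ≤ G n := by
      intro m n hmn
      refine AddSubgroup.closure_mono ?_
      rintro _ ⟨i, g, hg, rfl⟩
      exact ⟨i, g, hg.mono hmn, rfl⟩
    intro x
    induction x using TensorProduct.induction_on with
    | zero => exact ⟨0, zero_mem _⟩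
    | tmul i g => exact ⟨_, AddSubgroup.subset_closure ⟨i, g, isBelow_natDegree g, rfl⟩⟩
    | add x y hx hy =>
      obtain ⟨m, hm⟩ := hx
      obtain ⟨n, hn⟩ := hy
      exact ⟨max m n, add_mem (hmono (le_max_left _ _) hm) (hmono (le_max_right _ _) hn)⟩
  have key : ∀ n, ∀ x ∈ G n, I.subtype.rTensor (PolyFun V) x = 0 → x = 0 := by
    intro n
    induction n with
    | zero =>
      intro x hx _
      have : G 0 ≤ ⊥ := by
        refine (AddSubgroup.closure_le _).2 ?_
        rintro _ ⟨i, g, hg, rfl⟩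
        rw [hg.eq_zero, TensorProduct.tmul_zero]
        exact zero_mem _
      exact AddSubgroup.mem_bot.1 (this hx)
    | succ n ih =>
      intro x hx hx0
      have hfix : ∀ w : W, (actInv W w).lTensor I x = x := by
        refine hW.induction ?_ (fun w hw => ?_) (fun a b ha hb => ?_) (fun a ha => ?_)
        · rw [actInv_one, LinearMap.lTensor_id, LinearMap.id_apply]
        · obtain ⟨a, d, hd, hbelow⟩ := exists_demazure W w hw
          -- The operator d lowers the filtration by one and maps relations to relations, so the
          -- induction hypothesis applies. As w = 1 - a d, it follows that w fixes x.
          have hdx : d.lTensor I x = 0 := by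
            refine ih _ ?_ ?_
            · have : G (n + 1) ≤ (G n).comap (d.lTensor I).toAddMonoidHom := by
                refine (AddSubgroup.closure_le _).2 ?_
                rintro _ ⟨i, g, hg, rfl⟩
                exact AddSubgroup.subset_closure ⟨i, d g, hbelow n g hg, rfl⟩
              exact this hx
            · exact rTensor_lTensor_eq_zero I d hx0
          have h : actInv W w = LinearMap.id -
              LinearMap.mulLeft (invariantRing W) a ∘ₗ d := by
            ext f
            rw [LinearMap.sub_apply, LinearMap.comp_apply, LinearMap.mulLeft_apply, ← hd]
            simp [actInv_apply]
          rw [h, LinearMap.lTensor_sub, LinearMap.lTensor_comp, LinearMap.sub_apply,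
            LinearMap.comp_apply, hdx, map_zero, LinearMap.lTensor_id, sub_zero, LinearMap.id_apply]
        · rw [actInv_mul, LinearMap.lTensor_comp, LinearMap.comp_apply, hb, ha]
        · conv_lhs => rw [← ha]
          rw [← LinearMap.comp_apply, ← LinearMap.lTensor_comp, ← actInv_mul, inv_mul_cancel,
            actInv_one, LinearMap.lTensor_id, LinearMap.id_apply]
      refine eq_zero_of_lTensor_fixed I (actInv W) (transfer W) _ (subtype_comp_transfer W)
        (algebraMap ℂ (invariantRing W) (Nat.card W : ℂ)⁻¹) ?_ hfix hx0
      rw [← Nat.card_eq_fintype_card]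
      exact inv_card_mul_card W hW
  intro x hx
  obtain ⟨n, hn⟩ := hG x
  exact key n x hn hx

end ReflForms
end

/-! ### Freeness of flat graded modules -/

noncomputable section

namespace ReflForms

section Graded

variable {k R M : Type*} [Field k] [CommRing R] [IsDomain R] [Algebra k R] [AddCommGroup M]
  [Module k M] [Module R M] [IsScalarTower k R M]

/-- A flat, positively graded module over a graded domain with field of constants in degree zero
is free. The gradings are given by the projections to the homogeneous components. -/
theorem free_of_flat_of_graded [Module.Flat R M] (ε : R →ₐ[k] k) (cR : ℕ → R → R)
    (cM : ℕ → M →+ M) (hR : ∀ r, cR 0 r = algebraMap k R (ε r))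
    (hsum : ∀ m, ∃ N, ∑ n ∈ Finset.range N, cM n m = m)
    (hmul : ∀ n r m, cM n (r • m) =
      ∑ ij ∈ Finset.HasAntidiagonal.antidiagonal n, cR ij.1 r • cM ij.2 m)
    (hproj : ∀ i j m, cM i (cM j m) = if i = j then cM j m else 0)
    (hk : ∀ n (c : k) m, cM n (c • m) = c • cM n m) : Module.Free R M := by
  classical
  let I : Ideal R := RingHom.ker ε
  let N : Submodule R M := I • ⊤
  let X := {m : M // ∃ d, cM d m = m}
  let π : M →ₗ[k] M ⧸ N := N.mkQ.restrictScalars k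
  -- Homogeneous elements whose classes are independent in M / I M and span the classes of all
  -- homogeneous elements: these will be the basis.
  obtain ⟨κ, a, -, hspan, hli⟩ := exists_linearIndependent' k (fun m : X => π m.1)
  let b : κ → M := fun i => (a i).1
  have hπ : ∀ m, π m = 0 ↔ m ∈ N := fun m => Submodule.Quotient.mk_eq_zero N
  -- homogeneous elements lie in the span of `b`
  have hhom : ∀ d m, cM d m = m → m ∈ Submodule.span R (Set.range b) := by
    intro d
    induction d using Nat.strong_induction_on with
    | _ d ih =>
      intro m hm
      have h1 : π m ∈ Submodule.span k (Set.range (π ∘ b)) := by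
        change π m ∈ Submodule.span k (Set.range ((fun m : X => π m.1) ∘ a))
        rw [hspan]
        exact Submodule.subset_span ⟨⟨m, d, hm⟩, rfl⟩
      obtain ⟨c, hc⟩ := Finsupp.mem_span_range_iff_exists_finsupp.1 h1
      have h2 : m - c.sum (fun i r => r • b i) ∈ N := by
        rw [← hπ, map_sub, ← hc, map_finsuppSum]
        simp
      -- If ε r = 0, then r has no component of degree zero, so the degree d part of r • m' involves
      -- only components of m' of degree less than d.
      have h3 : ∀ n ∈ N, cM d n ∈ Submodule.span R (Set.range b) := by
        intro n hn
        refine Submodule.smul_induction_on hn (fun r hr m' _ => ?_) (fun x y hx hy => ?_)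
        · rw [hmul]
          refine Submodule.sum_mem _ fun ij hij => ?_
          obtain ⟨i, j⟩ := ij
          have hij : i + j = d := Finset.HasAntidiagonal.mem_antidiagonal.1 hij
          rcases Nat.eq_zero_or_pos i with rfl | hi
          · have : ε r = 0 := hr
            simp [hR, this]
          · exact Submodule.smul_mem _ _ (ih j (by omega) _ (by simp [hproj]))
        · rw [map_add]
          exact add_mem hx hy
      have h4 : m = c.sum (fun i r => r • cM d (b i)) +
          cM d (m - c.sum (fun i r => r • b i)) := by
        rw [map_sub, hm, map_finsuppSum]
        simp [hk]
      rw [h4]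
      refine add_mem (Submodule.sum_mem _ fun i _ => ?_) (h3 _ h2)
      obtain ⟨e, he⟩ := (a i).2
      change c i • cM d (b i) ∈ _
      rw [← algebraMap_smul R (c i)]
      refine Submodule.smul_mem _ _ ?_
      change cM d (a i).1 ∈ _
      rw [← he, hproj]
      split_ifs
      · rw [he]
        exact Submodule.subset_span ⟨i, rfl⟩
      · exact zero_mem _
  have htop : ⊤ ≤ Submodule.span R (Set.range b) := by
    intro m _
    obtain ⟨n, hn⟩ := hsum m
    rw [← hn]
    exact Submodule.sum_mem _ fun d _ => hhom d _ (by simp [hproj])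
  -- linear independence
  have hπsmul : ∀ (r : R) m, π (r • m) = ε r • π m := by
    intro r m
    rw [← map_smul, ← sub_eq_zero, ← map_sub, hπ, ← algebraMap_smul R (ε r) m, ← sub_smul]
    refine Submodule.smul_mem_smul ?_ trivial
    rw [RingHom.mem_ker, map_sub, AlgHom.commutes]
    simp
  have hindep : LinearIndependent R b := by
    rw [linearIndependent_iff']
    intro s r hr
    have hr' : ∑ i : s, r i • b i = 0 := by
      rw [← hr, Finset.sum_coe_sort s (fun i => r i • b i)]
    -- The equational criterion of flatness: b i = ∑ A i j • y j with ∑ r i * A i j = 0. The matrix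
    -- T below records the y j in terms of b.
    obtain ⟨n, A, y, hA, hrA⟩ := Module.Flat.isTrivialRelation_of_sum_smul_eq_zero hr'
    choose t ht using fun j =>
      Finsupp.mem_span_range_iff_exists_finsupp.1 (htop (Submodule.mem_top (x := y j)))
    let T : Matrix (Fin n) s R := Matrix.of fun j i => t j i
    let A' : Matrix s (Fin n) R := Matrix.of A
    -- Substituting the y j expresses the b i through b, and independence of their classes forces A'
    -- T to reduce to the identity under ε. Its determinant is thus nonzero in the domain R, and r
    -- A' T = 0 yields r = 0.
    have hdet : ε (A' * T).det = 1 := by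
      have hone : ε.toRingHom.mapMatrix (A' * T) = 1 := by
        ext i i'
        have hexp : π (b i) = (∑ j, ε (A i j) • (t j).mapRange ε (map_zero ε)).sum
            (fun l c => c • π (b l)) := by
          rw [← Finsupp.linearCombination_apply, map_sum, show b i = _ from hA i, map_sum]
          refine Finset.sum_congr rfl fun j _ => ?_
          rw [hπsmul, map_smul, ← ht j, map_finsuppSum]
          congr 1
          rw [Finsupp.linearCombination_apply, Finsupp.sum_mapRange_index (by simp)]
          exact Finsupp.sum_congr fun l _ => hπsmul _ _
        have hcoef : (∑ j, ε (A i j) • (t j).mapRange ε (map_zero ε)) =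
            Finsupp.single (i : κ) 1 := by
          apply hli
          change _ = Finsupp.linearCombination k (π ∘ b) _
          rw [Finsupp.linearCombination_single, one_smul]
          exact hexp.symm
        have := DFunLike.congr_fun hcoef (i' : κ)
        rw [Finsupp.finsetSum_apply] at this
        simp only [Finsupp.smul_apply, Finsupp.mapRange_apply, smul_eq_mul, ← map_mul] at this
        rw [RingHom.mapMatrix_apply, Matrix.map_apply, Matrix.mul_apply, map_sum]
        refine this.trans ?_
        rw [Finsupp.single_apply, Matrix.one_apply]
        exact if_congr Subtype.coe_inj rfl rfl
      have := RingHom.map_det ε.toRingHom (A' * T)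
      rw [hone, Matrix.det_one] at this
      exact this
    have hdet0 : (A' * T).det ≠ 0 := by
      intro h
      rw [h, map_zero] at hdet
      exact zero_ne_one hdet
    have hvec : Matrix.vecMul (fun i : s => r i) (A' * T) = 0 := by
      rw [← Matrix.vecMul_vecMul]
      have : Matrix.vecMul (fun i : s => r i) A' = 0 := by
        ext j
        exact hrA j
      rw [this, Matrix.zero_vecMul]
    have := Matrix.eq_zero_of_vecMul_eq_zero hdet0 hvec
    exact fun i hi => congrFun this ⟨i, hi⟩
  exact Module.Free.of_basis (Basis.mk hindep htop)

end Graded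

end ReflForms
end

/-! ### Freeness of the module of invariant derivations -/

noncomputable section

namespace ReflForms

variable {V : Type*} [NormedAddCommGroup V] [InnerProductSpace ℂ V]

/-! ### Derivations of the algebra of polynomial functions -/

theorem der_ext {θ η : Der V} (h : ∀ x, θ (lin V x) = η (lin V x)) : θ = η := by
  refine Derivation.ext fun f => ?_
  refine SymmetricAlgebra.induction (R := ℂ) (M := Dual ℂ V)
    (motive := fun f => θ (show PolyFun V from f) = η (show PolyFun V from f))
    (fun r => ?_) h (fun a b ha hb => ?_) (fun a b ha hb => ?_) f
  · exact (θ.map_algebraMap r).trans (η.map_algebraMap r).symm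
  · exact (θ.leibniz (show PolyFun V from a) b).trans (Eq.trans (by rw [ha, hb])
      (η.leibniz (show PolyFun V from a) b).symm)
  · exact (map_add θ (show PolyFun V from a) b).trans (Eq.trans (by rw [ha, hb])
      (map_add η (show PolyFun V from a) b).symm)

/-- The homomorphism `x ↦ x + φ x · ε` to the dual numbers. -/
def dualLift (φ : Dual ℂ V →ₗ[ℂ] PolyFun V) :
    PolyFun V →ₐ[ℂ] TrivSqZeroExt (PolyFun V) (PolyFun V) :=
  polyLift ((TrivSqZeroExt.inlAlgHom ℂ (PolyFun V) (PolyFun V)).toLinearMap ∘ₗ lin V +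
    ((TrivSqZeroExt.inrHom (PolyFun V) (PolyFun V)).restrictScalars ℂ) ∘ₗ φ)

theorem dualLift_lin (φ : Dual ℂ V →ₗ[ℂ] PolyFun V) (x : Dual ℂ V) :
    dualLift φ (lin V x) = TrivSqZeroExt.inl (lin V x) + TrivSqZeroExt.inr (φ x) := by
  simp [dualLift]

theorem fst_dualLift (φ : Dual ℂ V →ₗ[ℂ] PolyFun V) (f : PolyFun V) : (dualLift φ f).fst = f :=
  polyFun_hom_congr (F := (TrivSqZeroExt.fstHom ℂ (PolyFun V) (PolyFun V)).comp (dualLift φ))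
    (G := AlgHom.id ℂ _) (fun x => by simp [dualLift_lin]) f

/-- The derivation with given values on linear forms. -/
def derOf (φ : Dual ℂ V →ₗ[ℂ] PolyFun V) : Der V :=
  Derivation.mk' (((TrivSqZeroExt.sndHom (PolyFun V) (PolyFun V)).restrictScalars ℂ) ∘ₗ
    (dualLift φ).toLinearMap) (fun a b => by
      simp [fst_dualLift, mul_comm])

@[simp]
theorem derOf_lin (φ : Dual ℂ V →ₗ[ℂ] PolyFun V) (x : Dual ℂ V) : derOf φ (lin V x) = φ x := by
  change (dualLift φ (lin V x)).snd = _
  simp [dualLift_lin]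

theorem actDer_lin (g : V ≃ₗ[ℂ] V) (θ : Der V) (x : Dual ℂ V) :
    actDer g θ (lin V x) = actPoly g (θ (lin V (actDual g⁻¹ x))) := by
  rw [actDer_apply, actPoly_lin]

theorem actDer_mul (g h : V ≃ₗ[ℂ] V) (θ : Der V) : actDer (g * h) θ = actDer g (actDer h θ) := by
  refine Derivation.ext fun f => ?_
  rw [actDer_apply, actDer_apply, actDer_apply, mul_inv_rev, actPoly_mul, actPoly_mul]

section Coordinates

variable {ι : Type*} (x : Basis ι ℂ (Dual ℂ V))

/-- Derivations are determined by their values on coordinates, which are arbitrary. -/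
def derEquiv : Der V ≃ₗ[PolyFun V] (ι → PolyFun V) where
  toFun θ j := θ (lin V (x j))
  map_add' θ η := by ext; simp
  map_smul' f θ := by ext; simp
  invFun c := derOf (x.constr ℂ c)
  left_inv θ := by
    refine der_ext fun y => ?_
    rw [derOf_lin]
    have : x.constr ℂ (fun j => θ (lin V (x j))) = (θ : PolyFun V →ₗ[ℂ] PolyFun V) ∘ₗ lin V :=
      x.ext fun j => by
        rw [Basis.constr_basis]
        rfl
    rw [this]
    rfl
  right_inv c := by
    ext j
    exact (derOf_lin _ _).trans (x.constr_basis ℂ c j)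

@[simp]
theorem derEquiv_apply (θ : Der V) (j : ι) : derEquiv x θ j = θ (lin V (x j)) := rfl

end Coordinates

/-! ### Homogeneous components of derivations -/

/-- The part of a derivation whose coefficients are homogeneous of degree `n`. -/
def compDer (n : ℕ) : Der V →+ Der V where
  toFun θ := derOf (comp n ∘ₗ (θ : PolyFun V →ₗ[ℂ] PolyFun V) ∘ₗ lin V)
  map_zero' := der_ext fun x => by simp
  map_add' θ η := der_ext fun x => by simp

@[simp]
theorem compDer_lin (n : ℕ) (θ : Der V) (x : Dual ℂ V) :
    compDer n θ (lin V x) = comp n (θ (lin V x)) := by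
  simp [compDer]

theorem compDer_actDer (n : ℕ) (g : V ≃ₗ[ℂ] V) (θ : Der V) :
    compDer n (actDer g θ) = actDer g (compDer n θ) :=
  der_ext fun x => by simp [actDer_lin, comp_actPoly]

theorem der_sum_apply {ι : Type*} (s : Finset ι) (θ : ι → Der V) (f : PolyFun V) :
    (∑ i ∈ s, θ i) f = ∑ i ∈ s, θ i f := by
  classical
  induction s using Finset.induction_on with
  | empty => simp
  | insert a s ha ih => simp [Finset.sum_insert ha, ih]

theorem exists_sum_compDer [FiniteDimensional ℂ V] (θ : Der V) :
    ∃ N, ∑ n ∈ Finset.range N, compDer n θ = θ := by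
  let x := Module.finBasis ℂ (Dual ℂ V)
  refine ⟨Finset.univ.sup (fun j => (scale (θ (lin V (x j)))).natDegree) + 1, ?_⟩
  apply (derEquiv x).injective
  ext j
  simp only [derEquiv_apply, der_sum_apply, compDer_lin]
  exact sum_comp _ (Nat.lt_succ_of_le (Finset.le_sup (f := fun j =>
    (scale (θ (lin V (x j)))).natDegree) (Finset.mem_univ j)))

/-! ### Invariant derivations -/

variable (W : Subgroup (V ≃ₗ[ℂ] V))

theorem sum_actDer_mem [Fintype W] (θ : Der V) :
    ∑ w : W, actDer (w : V ≃ₗ[ℂ] V) θ ∈ invDer W := by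
  intro g hg
  rw [map_sum]
  refine Fintype.sum_equiv (Equiv.mulLeft (⟨g, hg⟩ : W)) _ _ fun w => ?_
  rw [← actDer_mul]
  rfl

/-- The action of an element of `W` on derivations as a linear map over the invariants. -/
def actDerInv (w : W) : Der V →ₗ[invariantRing W] Der V where
  toFun := actDer (w : V ≃ₗ[ℂ] V)
  map_add' := map_add _
  map_smul' r θ := by
    have h : r • θ = (r : PolyFun V) • θ := rfl
    have hr : actPoly (w : V ≃ₗ[ℂ] V) (r : PolyFun V) = r := r.2 w w.2
    rw [h, LinearMap.map_smulₛₗ]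
    simp only [RingHom.coe_coe, hr]
    rfl

local instance invDerModule : Module (invariantRing W) (invDer W) := Submodule.module _

/-- The sum over the group, as a linear map to the invariant derivations. -/
def transferDer [Fintype W] : Der V →ₗ[invariantRing W] invDer W :=
  (∑ w : W, actDerInv W w).codRestrict (invDer W) (fun θ => by
    rw [LinearMap.sum_apply]
    exact sum_actDer_mem W θ)

theorem coe_transferDer [Fintype W] (θ : Der V) :
    (transferDer W θ : Der V) = ∑ w : W, actDer (w : V ≃ₗ[ℂ] V) θ := by
  rw [transferDer, LinearMap.codRestrict_apply, LinearMap.sum_apply]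
  rfl

-- Der_S is free over S, hence flat over R because S is, and averaging over W is an R-linear
-- retraction onto the invariant derivations.
set_option synthInstance.maxHeartbeats 200000 in
theorem flat_invDer [FiniteDimensional ℂ V] (hW : IsUnitaryReflectionGroup W) :
    Module.Flat (invariantRing W) (invDer W) := by
  have := hW.finite
  have := Fintype.ofFinite W
  have := flat_polyFun W hW
  let x := Module.finBasis ℂ (Dual ℂ V)
  have : Module.Flat (PolyFun V) (Der V) := Module.Flat.of_linearEquiv (derEquiv x)
  have : Module.Flat (invariantRing W) (Der V) := Module.Flat.trans _ (PolyFun V) _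
  refine Module.Flat.of_retract (invDer W).subtype
    ((algebraMap ℂ (invariantRing W) (Nat.card W : ℂ)⁻¹) • transferDer W) ?_
  ext θ : 1
  apply Subtype.ext
  have h : ∀ w : W, actDer (w : V ≃ₗ[ℂ] V) (θ : Der V) = θ := fun w => θ.2 w w.2
  simp only [LinearMap.comp_apply, LinearMap.smul_apply, Submodule.subtype_apply,
    LinearMap.id_apply, Submodule.coe_smul, coe_transferDer, h, Finset.sum_const,
    Finset.card_univ, ← Nat.card_eq_fintype_card]
  rw [← Nat.cast_smul_eq_nsmul (invariantRing W), smul_smul, inv_card_mul_card W hW, one_smul]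

/-- Derivations are graded by the degree of their coefficients. The projections commute with W, and
the degree zero part of an invariant is its value at the origin. -/
theorem free_invDer [FiniteDimensional ℂ V] (hW : IsUnitaryReflectionGroup W) :
    Module.Free (invariantRing W) (invDer W) := by
  have := flat_invDer W hW
  let cM : ℕ → invDer W →+ invDer W := fun n =>
    { toFun := fun θ => ⟨compDer n θ, fun w hw => by rw [← compDer_actDer, θ.2 w hw]⟩
      map_zero' := Subtype.ext (map_zero _)
      map_add' := fun θ η => Subtype.ext (map_add _ _ _) }
  refine free_of_flat_of_graded (k := ℂ) ((evalAt 0).comp (invariantRing W).val)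
    (fun n r => ⟨comp n r, fun w hw => by rw [← comp_actPoly, r.2 w hw]⟩) cM
    (fun r => Subtype.ext (comp_zero _)) (fun θ => ?_) (fun n r θ => ?_) (fun i j θ => ?_)
    (fun n c θ => ?_)
  · obtain ⟨N, hN⟩ := exists_sum_compDer (θ : Der V)
    refine ⟨N, Subtype.ext ?_⟩
    rw [AddSubmonoidClass.coe_finsetSum]
    exact hN
  · refine Subtype.ext (der_ext fun x => ?_)
    rw [AddSubmonoidClass.coe_finsetSum, der_sum_apply]
    refine (compDer_lin _ _ _).trans ?_
    refine (comp_mul n (r : PolyFun V) _).trans (Finset.sum_congr rfl fun ij _ => ?_)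
    exact congrArg (comp ij.1 (r : PolyFun V) * ·) (compDer_lin ij.2 (θ : Der V) x).symm
  · refine Subtype.ext (der_ext fun x => ?_)
    change compDer i (compDer j (θ : Der V)) (lin V x) = _
    rw [compDer_lin, compDer_lin, comp_comp]
    split_ifs
    · exact (compDer_lin _ _ _).symm
    · rfl
  · refine Subtype.ext (der_ext fun x => ?_)
    refine (compDer_lin _ _ _).trans ?_
    refine ((comp n).map_smul c _).trans ?_
    exact congrArg (c • ·) (compDer_lin n (θ : Der V) x).symm

end ReflForms
end

noncomputable section

namespace ReflForms

variable {V : Type*} [NormedAddCommGroup V] [InnerProductSpace ℂ V]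

/-! ### Points in general position -/

/-- A product of affine forms, one for each t in T, vanishing at t and equal to one at v. -/
theorem exists_separating [FiniteDimensional ℂ V] (v : V) (T : Finset V) (hv : v ∉ T) :
    ∃ f : PolyFun V, evalAt v f = 1 ∧ ∀ t ∈ T, evalAt t f = 0 := by
  classical
  induction T using Finset.induction_on with
  | empty => exact ⟨1, map_one _, by simp⟩
  | insert t T ht ih =>
    rw [Finset.mem_insert, not_or] at hv
    obtain ⟨f, hf, hfT⟩ := ih hv.2
    obtain ⟨y, hy⟩ : ∃ y : Dual ℂ V, y (v - t) ≠ 0 := by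
      by_contra! H
      exact hv.1 (sub_eq_zero.1 ((Module.forall_dual_apply_eq_zero_iff ℂ _).1 H))
    refine ⟨f * ((y (v - t))⁻¹ • (lin V y - algebraMap ℂ _ (y t))), ?_, ?_⟩
    · rw [map_mul, hf, map_smul, map_sub (evalAt v), AlgHom.commutes, evalAt_lin]
      simp only [Algebra.algebraMap_self_apply, smul_eq_mul]
      rw [← map_sub, inv_mul_cancel₀ hy, one_mul]
    · intro s hs
      rw [Finset.mem_insert] at hs
      rw [map_mul]
      rcases hs with rfl | hs
      · rw [map_smul, map_sub (evalAt s), AlgHom.commutes, evalAt_lin]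
        simp
      · rw [hfT s hs, zero_mul]

/-- Restriction of polynomial functions to the line through `v` in direction `u`. -/
def onLine (v u : V) : PolyFun V →ₐ[ℂ] Polynomial ℂ :=
  polyLift ((Polynomial.CAlgHom (R := ℂ) (A := ℂ)).toLinearMap ∘ₗ Dual.eval ℂ V v +
    (Dual.eval ℂ V u).smulRight (Polynomial.X : Polynomial ℂ))

theorem onLine_lin (v u : V) (y : Dual ℂ V) :
    onLine v u (lin V y) = Polynomial.C (y v) + y u • Polynomial.X := by
  simp [onLine]

theorem eval_onLine (v u : V) (t : ℂ) (f : PolyFun V) :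
    (onLine v u f).eval t = evalAt (v + t • u) f :=
  polyFun_hom_congr (F := (Polynomial.aeval (R := ℂ) t).comp (onLine v u))
    (G := evalAt (v + t • u)) (fun y => by simp [onLine_lin, mul_comm]) f

/-- Translation of polynomial functions. -/
def translate (u : V) : PolyFun V →ₐ[ℂ] PolyFun V :=
  polyLift (lin V + (Dual.eval ℂ V u).smulRight (1 : PolyFun V))

theorem evalAt_translate (u v : V) (f : PolyFun V) :
    evalAt v (translate u f) = evalAt (v + u) f :=
  polyFun_hom_congr (F := (evalAt v).comp (translate u)) (G := evalAt (v + u))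
    (fun y => by simp [translate]) f

/-- A polynomial function without zeros outside finitely many subspaces of codimension at least
two is constant. -/
theorem exists_eq_algebraMap_of_ne_zero [FiniteDimensional ℂ V] (s : Finset (Submodule ℂ V))
    (hs : ∀ U ∈ s, finrank ℂ U + 2 ≤ finrank ℂ V) (g : PolyFun V)
    (hg : ∀ v, (∀ U ∈ s, v ∉ U) → evalAt v g ≠ 0) :
    ∃ c : ℂ, g = algebraMap ℂ (PolyFun V) c := by
  refine ⟨evalAt 0 g, eq_of_evalAt fun b => ?_⟩
  rw [AlgHom.commutes, Algebra.algebraMap_self_apply]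
  by_contra hne
  -- Codimension two leaves room for a hyperplane containing both U and b. Its form is constant
  -- along lines of direction b, so such a line avoids U as soon as one of its points is off the
  -- hyperplane.
  have hdual : ∀ U ∈ s, ∃ y : Dual ℂ V, y ≠ 0 ∧ U ≤ LinearMap.ker y ∧ y b = 0 := by
    intro U hU
    have hlt : U ⊔ ℂ ∙ b < ⊤ := by
      rw [lt_top_iff_ne_top]
      intro htop
      have h1 := Submodule.finrank_add_le_finrank_add_finrank U (ℂ ∙ b)
      have h2 := finrank_span_le_card (R := ℂ) ({b} : Set V)
      rw [htop, finrank_top] at h1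
      simp only [Set.toFinset_singleton, Finset.card_singleton] at h2
      have := hs U hU
      omega
    obtain ⟨y, hy0, hy⟩ := Submodule.exists_le_ker_of_lt_top _ hlt
    exact ⟨y, hy0, le_sup_left.trans hy,
      hy (Submodule.mem_sup_right (Submodule.mem_span_singleton_self b))⟩
  choose! y hy0 hyU hyb using hdual
  have hprod : (translate b g - g) * ∏ U ∈ s, lin V (y U) ≠ 0 := by
    refine mul_ne_zero (fun h => hne ?_) (Finset.prod_ne_zero_iff.2 fun U hU =>
      lin_ne_zero (hy0 U hU))
    have := congrArg (evalAt 0) h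
    rw [map_sub, evalAt_translate, zero_add, map_zero, sub_eq_zero] at this
    exact this
  obtain ⟨z, hz⟩ := exists_evalAt_ne_zero hprod
  rw [map_mul, map_prod, mul_ne_zero_iff, map_sub, evalAt_translate, sub_ne_zero,
    Finset.prod_ne_zero_iff] at hz
  -- g takes different values at z and z + b, so it is not constant on this line and has a root
  -- there, outside all the subspaces.
  have hdeg : (onLine z b g).degree ≠ 0 := by
    intro h
    have h1 := eval_onLine z b 1 g
    have h0 := eval_onLine z b 0 g
    rw [Polynomial.eq_C_of_degree_eq_zero h, Polynomial.eval_C] at h0 h1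
    rw [one_smul] at h1
    rw [zero_smul, add_zero] at h0
    exact hz.1 (h1.symm.trans h0)
  obtain ⟨t, ht⟩ := IsAlgClosed.exists_root _ hdeg
  rw [Polynomial.IsRoot.def, eval_onLine] at ht
  refine hg _ (fun U hU hmem => ?_) ht
  have := hyU U hU hmem
  rw [LinearMap.mem_ker, map_add, map_smul, hyb U hU, smul_zero, add_zero] at this
  exact hz.2 U hU (by rw [evalAt_lin, this])

/-! ### Averages of vector fields -/

variable (W : Subgroup (V ≃ₗ[ℂ] V))

/-- The average over the group of the vector field `f · u`. -/
def avgField [Fintype W] (f : PolyFun V) (u : V) : invDer W :=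
  ⟨_, sum_actDer_mem W (derOf ((Dual.eval ℂ V u).smulRight f))⟩

theorem avgField_lin [Fintype W] (f : PolyFun V) (u : V) (y : Dual ℂ V) :
    (avgField W f u : Der V) (lin V y) =
      ∑ w : W, y ((w : V ≃ₗ[ℂ] V) u) • actPoly (w : V ≃ₗ[ℂ] V) f := by
  rw [avgField, der_sum_apply]
  refine Finset.sum_congr rfl fun w _ => ?_
  rw [actDer_lin, derOf_lin, LinearMap.smulRight_apply, map_smul, Dual.eval_apply, actDual_apply,
    inv_inv]

/-- There is a polynomial function with value one at a given point and value zero at the rest of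
its orbit. -/
theorem exists_orbit_separating [FiniteDimensional ℂ V] [Fintype W] (v : V) :
    ∃ f : PolyFun V, evalAt v f = 1 ∧
      ∀ w : W, (w : V ≃ₗ[ℂ] V) v ≠ v → evalAt v (actPoly (w : V ≃ₗ[ℂ] V) f) = 0 := by
  classical
  obtain ⟨f, hf, hf0⟩ := exists_separating v
    ((Finset.univ.image fun w : W => (w : V ≃ₗ[ℂ] V)⁻¹ v).erase v) (Finset.notMem_erase _ _)
  refine ⟨f, hf, fun w hw => ?_⟩
  rw [evalAt_actPoly]
  refine hf0 _ (Finset.mem_erase.2 ⟨fun h => hw ?_, Finset.mem_image_of_mem _ (Finset.mem_univ w)⟩)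
  conv_lhs => rw [← h]
  exact (w : V ≃ₗ[ℂ] V).apply_symm_apply v

/-- V is not the union of finitely many proper subspaces, here the fixed spaces of the nontrivial
elements. -/
theorem exists_trivial_stabilizer [Finite W] :
    ∃ v : V, ∀ w ∈ W, w v = v → w = 1 := by
  classical
  have := Fintype.ofFinite W
  let s : Finset (Submodule ℂ V) :=
    Finset.image (fun w : W => fixedSpace (w : V ≃ₗ[ℂ] V))
      (Finset.filter (fun w : W => w ≠ 1) Finset.univ)
  have hs : ⊤ ∉ s := by
    intro h
    obtain ⟨w, hw, hw'⟩ := Finset.mem_image.1 h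
    refine (Finset.mem_filter.1 hw).2 (Subtype.ext (LinearEquiv.ext fun v => ?_))
    exact mem_fixedSpace.1 (hw' ▸ Submodule.mem_top)
  have hne := Subspace.biUnion_ne_univ_of_top_notMem hs
  obtain ⟨v, hv⟩ := (Set.ne_univ_iff_exists_notMem _).1 hne
  refine ⟨v, fun w hw hwv => ?_⟩
  by_contra h1
  refine hv (Set.mem_biUnion (Finset.mem_image.2 ⟨⟨w, hw⟩, Finset.mem_filter.2
    ⟨Finset.mem_univ _, fun h => h1 (congrArg Subtype.val h)⟩, rfl⟩) ?_)
  exact mem_fixedSpace.2 hwv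

end ReflForms
end

noncomputable section

namespace ReflForms

variable {V : Type*} [NormedAddCommGroup V] [InnerProductSpace ℂ V]
variable (W : Subgroup (V ≃ₗ[ℂ] V))

attribute [local instance] invDerModule

/-! ### The rank of the module of invariant derivations -/

theorem span_comp_basis {R k M N κ : Type*} [CommRing R] [CommRing k] [AddCommGroup M]
    [Module R M] [AddCommGroup N] [Module k N] {σ : R →+* k} (L : M →ₛₗ[σ] N)
    (b : Basis κ R M) (hL : Submodule.span k (Set.range L) = ⊤) :
    Submodule.span k (Set.range (L ∘ b)) = ⊤ := by
  rw [eq_top_iff, ← hL, Submodule.span_le]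
  rintro _ ⟨m, rfl⟩
  rw [← b.linearCombination_repr m, Finsupp.linearCombination_apply, map_finsuppSum]
  refine Submodule.sum_mem _ fun i _ => ?_
  change L (b.repr m i • b i) ∈ _
  rw [L.map_smulₛₗ]
  exact Submodule.smul_mem _ _ (Submodule.subset_span ⟨i, rfl⟩)

theorem actPoly_ne_zero (g : V ≃ₗ[ℂ] V) {f : PolyFun V} (hf : f ≠ 0) : actPoly g f ≠ 0 := by
  intro h
  apply hf
  rw [← actPoly_one f, ← inv_mul_cancel g, actPoly_mul, h, map_zero]

/-- Every nonzero polynomial function divides a nonzero invariant. -/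
theorem exists_mul_mem_invariantRing [Finite W] {f : PolyFun V} (hf : f ≠ 0) :
    ∃ h, f * h ∈ invariantRing W ∧ f * h ≠ 0 := by
  classical
  have := Fintype.ofFinite W
  -- The product with f is the norm of f, the product of all its translates.
  refine ⟨∏ w ∈ Finset.univ.erase (1 : W), actPoly (w : V ≃ₗ[ℂ] V) f, ?_⟩
  have h : f * ∏ w ∈ Finset.univ.erase (1 : W), actPoly (w : V ≃ₗ[ℂ] V) f =
      ∏ w : W, actPoly (w : V ≃ₗ[ℂ] V) f := by
    rw [← Finset.mul_prod_erase Finset.univ _ (Finset.mem_univ (1 : W))]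
    congr 1
    exact (actPoly_one f).symm
  rw [h]
  refine ⟨fun g hg => ?_, Finset.prod_ne_zero_iff.2 fun w _ => actPoly_ne_zero _ hf⟩
  rw [map_prod]
  refine Fintype.prod_equiv (Equiv.mulLeft (⟨g, hg⟩ : W)) _ _ fun w => ?_
  rw [← actPoly_mul]
  rfl

theorem actDer_smul_invDer (w : V ≃ₗ[ℂ] V) (hw : w ∈ W) (f : PolyFun V) (θ : invDer W) :
    actDer w (f • (θ : Der V)) = actPoly w f • (θ : Der V) := by
  rw [LinearMap.map_smulₛₗ, θ.2 w hw]
  rfl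

/-- Invariant derivations that are independent over the invariants are independent. -/
theorem linearIndependent_invDer [Finite W] {κ : Type*} {b : κ → invDer W}
    (hb : LinearIndependent (invariantRing W) b) :
    LinearIndependent (PolyFun V) (fun i => (b i : Der V)) := by
  classical
  have := Fintype.ofFinite W
  rw [linearIndependent_iff'] at hb ⊢
  intro s g hg
  by_contra! H
  obtain ⟨i, hi, hgi⟩ := H
  -- Multiplying the relation by h makes its i-th coefficient invariant. The transfer produces a
  -- relation over R and only multiplies this coefficient by |W|, so it does not annihilate it.
  obtain ⟨h, hinv, hne⟩ := exists_mul_mem_invariantRing W hgi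
  have h0 : ∑ j ∈ s, (h * g j) • (b j : Der V) = 0 := by
    simp only [mul_smul, ← Finset.smul_sum, hg, smul_zero]
  have key : ∑ j ∈ s, transfer W (h * g j) • b j = 0 := by
    apply Subtype.ext
    rw [AddSubmonoidClass.coe_finsetSum]
    have h1 : ∑ w : W, actDer (w : V ≃ₗ[ℂ] V) (∑ j ∈ s, (h * g j) • (b j : Der V)) = 0 := by
      simp [h0]
    simp only [map_sum (actDer _), actDer_smul_invDer W _ (SetLike.coe_mem _)] at h1
    rw [Finset.sum_comm] at h1
    simp only [← Finset.sum_smul] at h1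
    exact h1
  have h2 := hb s _ key i hi
  have h3 : (Nat.card W : PolyFun V) * (g i * h) = 0 := by
    have h4 : (∑ w : W, actPoly (w : V ≃ₗ[ℂ] V) (h * g i)) = 0 := congrArg Subtype.val h2
    rw [mul_comm h] at h4
    simp only [fun w : W => hinv w w.2, Finset.sum_const, Finset.card_univ] at h4
    rwa [Nat.card_eq_fintype_card, ← nsmul_eq_mul]
  have h5 : (Nat.card W : PolyFun V) ≠ 0 := by
    rw [← map_natCast (algebraMap ℂ (PolyFun V)), map_ne_zero_iff _
      (algebraMap ℂ (PolyFun V)).injective]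
    exact Nat.cast_ne_zero.2 Nat.card_pos.ne'
  exact (mul_ne_zero h5 hne) h3

/-- Evaluation of polynomial functions in the invariants. -/
def evalInv (v : V) : invariantRing W →+* ℂ := ((evalAt v).comp (invariantRing W).val).toRingHom

/-- The vector of values of a vector field at a point. -/
def valueAt {ι : Type*} (e : Basis ι ℂ V) (v : V) : invDer W →ₛₗ[evalInv W v] (ι → ℂ) where
  toFun θ j := evalAt v ((θ : Der V) (lin V (e.coord j)))
  map_add' θ η := by ext; simp
  map_smul' r θ := by
    ext j
    exact map_mul (evalAt v) (r : PolyFun V) _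

/-- Let f be one at v and zero on the rest of its orbit. As the stabilizer is trivial, only the
identity contributes at v to the average of f · u, whose value there is u. -/
theorem span_valueAt {ι : Type*} [Finite ι] [FiniteDimensional ℂ V] [Finite W]
    (e : Basis ι ℂ V) {v : V} (hv : ∀ w ∈ W, w v = v → w = 1) :
    Submodule.span ℂ (Set.range (valueAt W e v)) = ⊤ := by
  classical
  have := Fintype.ofFinite ι
  have := Fintype.ofFinite W
  obtain ⟨f, hf, hf0⟩ := exists_orbit_separating W v
  rw [eq_top_iff, ← (Pi.basisFun ℂ ι).span_eq, Submodule.span_le]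
  rintro _ ⟨i, rfl⟩
  refine Submodule.subset_span ⟨avgField W f (e i), ?_⟩
  ext j
  change evalAt v ((avgField W f (e i) : Der V) (lin V (e.coord j))) = _
  rw [avgField_lin, map_sum, Finset.sum_eq_single (1 : W)]
  · rw [map_smul]
    have : actPoly ((1 : W) : V ≃ₗ[ℂ] V) f = f := actPoly_one f
    rw [this, hf]
    simp [Finsupp.single_apply, Pi.single_apply, eq_comm]
  · intro w _ hw
    rw [map_smul, hf0 w (fun h => hw (Subtype.ext (hv w w.2 h))), smul_zero]
  · exact fun h => absurd (Finset.mem_univ _) h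

/-- The module of invariant derivations of a reflection group is free of rank `dim V`. -/
theorem exists_basis_invDer [FiniteDimensional ℂ V] (hW : IsUnitaryReflectionGroup W) {ℓ : ℕ}
    (hℓ : finrank ℂ V = ℓ) : Nonempty (Basis (Fin ℓ) (invariantRing W) (invDer W)) := by
  have := hW.finite
  obtain ⟨⟨κ, b⟩⟩ := (free_invDer W hW).exists_basis
  let e : Basis (Fin ℓ) ℂ V := (Module.finBasis ℂ V).reindex (finCongr hℓ)
  have hli := linearIndependent_invDer W b.linearIndependent
  have : Module.Finite (PolyFun V) (Der V) := Module.Finite.equiv (derEquiv e.dualBasis).symm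
  have : Finite κ := hli.finite
  have := Fintype.ofFinite κ
  -- The basis stays independent over S in Der_S, which is free of rank ℓ.
  have h1 : Fintype.card κ ≤ ℓ := by
    have := hli.fintype_card_le_finrank
    rwa [(derEquiv e.dualBasis).finrank_eq, Module.finrank_fin_fun] at this
  -- At a point with trivial stabilizer the values of the basis span a space of dimension ℓ.
  have h2 : ℓ ≤ Fintype.card κ := by
    obtain ⟨v, hv⟩ := exists_trivial_stabilizer W
    have hspan := span_comp_basis _ b (span_valueAt W e hv)
    have := finrank_range_le_card (R := ℂ) (valueAt W e v ∘ b)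
    rwa [Set.finrank, hspan, finrank_top, Module.finrank_fin_fun] at this
  exact ⟨b.reindex (Fintype.equivFinOfCardEq (h1.antisymm h2))⟩

end ReflForms
end

noncomputable section

namespace ReflForms

variable {V : Type*} [NormedAddCommGroup V] [InnerProductSpace ℂ V]
variable (W : Subgroup (V ≃ₗ[ℂ] V))

attribute [local instance] invDerModule

/-! ### Semi-invariants -/

variable {W} in
theorem definingPoly_eq_prod (hW : IsUnitaryReflectionGroup W) (α : Submodule ℂ V → Dual ℂ V) :
    definingPoly W α = ∏ H ∈ (hyperplanes_finite W hW).toFinset, lin V (α H) :=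
  finprod_mem_eq_finite_toFinset_prod _ _

variable {W} in
theorem lin_dvd_definingPoly (hW : IsUnitaryReflectionGroup W) (α : Submodule ℂ V → Dual ℂ V)
    {H : Submodule ℂ V} (hH : H ∈ hyperplanes W) :
    lin V (α H) ∣ definingPoly W α := by
  rw [definingPoly_eq_prod hW]
  exact Finset.dvd_prod_of_mem _ ((Set.Finite.mem_toFinset _).2 hH)

section SemiInvariants

variable {W} [FiniteDimensional ℂ V] {α : Submodule ℂ V → Dual ℂ V}
  (hα : ∀ H ∈ hyperplanes W, LinearMap.ker (α H) = H)
include hα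

theorem linearForm_ne_zero {H : Submodule ℂ V} (hH : H ∈ hyperplanes W) : α H ≠ 0 := by
  intro h
  have h1 := hα H hH
  rw [h, LinearMap.ker_zero] at h1
  obtain ⟨w, -, hw, rfl⟩ := hH
  exact hw.fixedSpace_ne_top h1.symm

/-- The factors are prime, and none divides another: divisibility would give an inclusion, hence an
equality, of hyperplanes. -/
theorem prod_lin_dvd {f : PolyFun V} (s : Finset (Submodule ℂ V)) (hs : ↑s ⊆ hyperplanes W)
    (hf : ∀ H ∈ s, lin V (α H) ∣ f) : ∏ H ∈ s, lin V (α H) ∣ f := by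
  classical
  induction s using Finset.induction_on with
  | empty => simp
  | insert H s hH ih =>
    rw [Finset.coe_insert, Set.insert_subset_iff] at hs
    rw [Finset.prod_insert hH]
    obtain ⟨g, hg⟩ := ih hs.2 fun H' hH' => hf H' (Finset.mem_insert_of_mem hH')
    have hp := prime_lin (linearForm_ne_zero hα hs.1)
    have hd := hf H (Finset.mem_insert_self _ _)
    rw [hg] at hd ⊢
    rcases hp.dvd_or_dvd hd with h | h
    · obtain ⟨H', hH', h'⟩ := (hp.dvd_finsetProd_iff _).1 h
      have hle := ker_le_of_lin_dvd_lin h'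
      rw [hα H hs.1, hα H' (hs.2 hH')] at hle
      have : H = H' := by
        refine Submodule.eq_of_le_of_finrank_eq hle ?_
        obtain ⟨w, -, hw, rfl⟩ := hs.1
        obtain ⟨w', -, hw', rfl⟩ := hs.2 hH'
        rw [IsReflection] at hw hw'
        omega
      exact absurd (this ▸ hH') hH
    · rw [mul_comm]
      exact mul_dvd_mul_left _ h

variable (hW : IsUnitaryReflectionGroup W)
include hW

theorem definingPoly_ne_zero : definingPoly W α ≠ 0 := by
  rw [definingPoly_eq_prod hW, Finset.prod_ne_zero_iff]
  intro H hH
  exact lin_ne_zero (linearForm_ne_zero hα ((Set.Finite.mem_toFinset _).1 hH))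

/-- Polynomial functions transforming by the inverse determinant are divisible by the product of
the forms defining the reflecting hyperplanes. -/
theorem definingPoly_dvd {f : PolyFun V} (hf : ∀ w ∈ W, actPoly w f = detInv w • f) :
    definingPoly W α ∣ f := by
  rw [definingPoly_eq_prod hW]
  refine prod_lin_dvd hα _ (by simp) fun H hH => ?_
  have hH' := (Set.Finite.mem_toFinset _).1 hH
  have hk := hα H hH'
  obtain ⟨w, hw, hr, rfl⟩ := hH'
  exact lin_dvd_of_semiinvariant hr (hW.isOfFinOrder hw) hk (hf w hw)

end SemiInvariants

/-! ### The determinant of a basis of invariant derivations -/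

section Det

variable {W} {ι : Type*} [Fintype ι] [DecidableEq ι] (e : Basis ι ℂ V) (θ : ι → invDer W)

/-- The coefficient matrix of a family of derivations. -/
def coeffMatrix : Matrix ι ι (PolyFun V) :=
  Matrix.of fun i j => (θ i : Der V) (lin V (e.coord j))

theorem invDer_apply_actDual (θ : invDer W) {w : V ≃ₗ[ℂ] V} (hw : w ∈ W) (y : Dual ℂ V) :
    (θ : Der V) (lin V (actDual w y)) = actPoly w ((θ : Der V) (lin V y)) := by
  conv_lhs => rw [← θ.2 w hw]
  rw [actDer_lin]
  congr 3
  ext v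
  simp [actDual_apply]

theorem det_actDual [FiniteDimensional ℂ V] (w : V ≃ₗ[ℂ] V) :
    LinearMap.det (actDual w) = detInv w := by
  rw [actDual, LinearMap.det_dualMap, det_inv_eq]

/-- As the derivations are invariant, w acts on their coefficient matrix through the coordinates
only: it multiplies it on the right by the constant matrix of the contragredient action. -/
theorem actPoly_det_coeffMatrix [FiniteDimensional ℂ V] {w : V ≃ₗ[ℂ] V} (hw : w ∈ W) :
    actPoly w (coeffMatrix e θ).det = detInv w • (coeffMatrix e θ).det := by
  have h := AlgHom.map_det (actPoly w) (coeffMatrix e θ)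
  rw [h]
  have h1 : (actPoly w).mapMatrix (coeffMatrix e θ) = coeffMatrix e θ *
      (LinearMap.toMatrix e.dualBasis e.dualBasis (actDual w)).map (algebraMap ℂ (PolyFun V)) := by
    ext i j
    rw [AlgHom.mapMatrix_apply, Matrix.map_apply, Matrix.mul_apply, coeffMatrix, Matrix.of_apply,
      ← invDer_apply_actDual (θ i) hw, ← e.dualBasis.sum_repr (actDual w (e.coord j)), map_sum,
      map_sum]
    refine Finset.sum_congr rfl fun k _ => ?_
    rw [map_smul, Derivation.map_smul, Matrix.map_apply, LinearMap.toMatrix_apply,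
      Algebra.smul_def, mul_comm]
    simp
  rw [h1, Matrix.det_mul, ← RingHom.mapMatrix_apply, ← RingHom.map_det, LinearMap.det_toMatrix,
    det_actDual, mul_comm, Algebra.smul_def]

end Det

theorem det_ne_zero_of_span {ι : Type*} [Fintype ι] [DecidableEq ι] {A : Matrix ι ι ℂ}
    (h : Submodule.span ℂ (Set.range A.row) = ⊤) : A.det ≠ 0 := by
  have hli := linearIndependent_of_top_le_span_of_card_eq_finrank h.ge
    (Module.finrank_fintype_fun_eq_card ℂ).symm
  rw [Matrix.linearIndependent_rows_iff_isUnit, Matrix.isUnit_iff_isUnit_det] at hli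
  exact hli.ne_zero

/-! ### Where the determinant vanishes, and to which order -/

section Values

variable {W} {ι : Type*} [Fintype ι] [DecidableEq ι] [FiniteDimensional ℂ V] (e : Basis ι ℂ V)
  (θ : Basis ι (invariantRing W) (invDer W))

theorem evalAt_det_ne_zero_of_trivial_stabilizer [Finite W] {v : V}
    (hv : ∀ w ∈ W, w v = v → w = 1) : evalAt v (coeffMatrix e θ).det ≠ 0 := by
  rw [AlgHom.map_det]
  refine det_ne_zero_of_span ?_
  have hrow : ((evalAt v).mapMatrix (coeffMatrix e θ)).row = valueAt W e v ∘ θ := by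
    funext i j
    rfl
  rw [hrow]
  exact span_comp_basis _ θ (span_valueAt W e hv)

/-- If `v` is fixed by nothing but elements fixing `ker β`, then the determinant of a basis of
invariant derivations vanishes to first order only along `ker β` at `v`. -/
theorem evalAt_ne_zero_of_det_eq [Finite W] {v : V} {β : Dual ℂ V} (hβ : β ≠ 0) (hβv : β v = 0)
    (hstab : ∀ w ∈ W, w v = v → LinearMap.ker β ≤ fixedSpace w)
    (hdvd : ∀ η : invDer W, lin V β ∣ (η : Der V) (lin V β)) {g : PolyFun V}
    (hg : (coeffMatrix e θ).det = lin V β * g) : evalAt v g ≠ 0 := by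
  classical
  have := Fintype.ofFinite W
  have hb0 := lin_ne_zero hβ
  -- With this choice β can replace the coordinate of index i₀.
  obtain ⟨i₀, hi₀⟩ : ∃ i, β (e i) ≠ 0 := by
    by_contra! H
    exact hβ (e.ext fun i => by simp [H i])
  have hβsum : β = ∑ j, β (e j) • e.coord j := e.ext fun j => by simp
  choose q hq using hdvd
  -- the values of `η β / β` and of the other coordinates of `η`
  let L : invDer W →ₛₗ[evalInv W v] (ι → ℂ) :=
    { toFun := fun η j => if j = i₀ then evalAt v (q η) else
        evalAt v ((η : Der V) (lin V (e.coord j)))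
      map_add' := fun η ξ => by
        have : q (η + ξ) = q η + q ξ := by
          apply mul_left_cancel₀ hb0
          rw [mul_add, ← hq, ← hq, ← hq]
          rfl
        ext j
        by_cases hj : j = i₀ <;> simp [hj, this]
      map_smul' := fun r η => by
        have : q (r • η) = (r : PolyFun V) * q η := by
          apply mul_left_cancel₀ hb0
          rw [mul_left_comm, ← hq, ← hq]
          rfl
        ext j
        change _ = evalAt v (r : PolyFun V) * (if j = i₀ then evalAt v (q η) else
          evalAt v ((η : Der V) (lin V (e.coord j))))
        by_cases hj : j = i₀
        · simp only [hj, if_true, this, map_mul]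
        · simp only [hj, if_false]
          exact map_mul (evalAt v) (r : PolyFun V) _ }
  have hL₀ : ∀ η, L η i₀ = evalAt v (q η) := fun η => if_pos rfl
  have hL₁ : ∀ η j, j ≠ i₀ → L η j = evalAt v ((η : Der V) (lin V (e.coord j))) :=
    fun η j hj => if_neg hj
  obtain ⟨f, hf, hf0⟩ := exists_orbit_separating W v
  have hf1 : ∀ w : W, (w : V ≃ₗ[ℂ] V) v = v → evalAt v (actPoly (w : V ≃ₗ[ℂ] V) f) = 1 := by
    intro w hw
    have : (w : V ≃ₗ[ℂ] V)⁻¹ v = v := mem_fixedSpace.1 (by rwa [fixedSpace_inv, mem_fixedSpace])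
    rw [evalAt_actPoly, this, hf]
  -- The sum is the order of the stabilizer of v.
  have hN : ∑ w : W, (if (w : V ≃ₗ[ℂ] V) v = v then (1 : ℂ) else 0) ≠ 0 := by
    rw [Finset.sum_boole]
    refine Nat.cast_ne_zero.2 (Finset.card_pos.2 ⟨1, ?_⟩).ne'
    simp
  -- a field transversal to the hyperplane
  have hnormal : ∃ η, L η i₀ ≠ 0 ∧ ∀ j, j ≠ i₀ → L η j = 0 := by
    obtain ⟨u, hu⟩ := exists_apply_eq_one hβ
    -- On the line v + t u the form β is the parameter. In the β-component divided by β, an element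
    -- w fixing v contributes one at v, since the factors det and det⁻¹ coming from β (w u) and w β
    -- cancel. For the other w the function w f vanishes at v, and the square leaves a zero after
    -- the division. The remaining components vanish at v because of β or of f.
    refine ⟨avgField W (f ^ 2 * lin V β) u, ?_, fun j hj => ?_⟩
    · have hX : onLine v u (lin V β) = Polynomial.X := by
        rw [onLine_lin, hβv, hu]
        simp
      have hterm : ∀ w : W, ∃ p : Polynomial ℂ, onLine v u (β ((w : V ≃ₗ[ℂ] V) u) •
          actPoly (w : V ≃ₗ[ℂ] V) (f ^ 2 * lin V β)) = Polynomial.X * p ∧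
          p.eval 0 = if (w : V ≃ₗ[ℂ] V) v = v then 1 else 0 := by
        intro w
        by_cases hw : (w : V ≃ₗ[ℂ] V) v = v
        · refine ⟨onLine v u (actPoly (w : V ≃ₗ[ℂ] V) f) ^ 2, ?_, ?_⟩
          · have hk := hstab w w.2 hw
            rw [dual_apply_of_ker_le hβ hk, hu, mul_one, map_mul, actPoly_lin,
              actDual_of_ker_le hβ hk, map_smul (lin V), mul_smul_comm, smul_smul,
              mul_comm (LinearMap.det _), detInv_mul, one_smul, map_mul, hX, map_pow, map_pow,
              mul_comm]
          · rw [Polynomial.eval_pow, eval_onLine, zero_smul, add_zero, hf1 w hw, if_pos hw, one_pow]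
        · have hroot : Polynomial.X ∣ onLine v u (actPoly (w : V ≃ₗ[ℂ] V) f) := by
            rw [Polynomial.X_dvd_iff, Polynomial.coeff_zero_eq_eval_zero, eval_onLine, zero_smul,
              add_zero, hf0 w hw]
          obtain ⟨r, hr⟩ := hroot
          refine ⟨Polynomial.X * (β ((w : V ≃ₗ[ℂ] V) u) • (r ^ 2 *
            onLine v u (actPoly (w : V ≃ₗ[ℂ] V) (lin V β)))), ?_, ?_⟩
          · rw [map_smul, map_mul, map_mul, map_pow, map_pow, hr, mul_smul_comm, mul_smul_comm]
            congr 1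
            ring
          · rw [Polynomial.eval_mul, Polynomial.eval_X, zero_mul, if_neg hw]
      choose p hp hp0 using hterm
      have hq' := hq (avgField W (f ^ 2 * lin V β) u)
      rw [avgField_lin] at hq'
      have h1 := congrArg (onLine v u) hq'
      rw [map_sum, map_mul, hX, Finset.sum_congr rfl fun w _ => hp w, ← Finset.mul_sum] at h1
      have h2 := congrArg (Polynomial.eval 0) (mul_left_cancel₀ Polynomial.X_ne_zero h1)
      rw [eval_onLine, zero_smul, add_zero, Polynomial.eval_finsetSum,
        Finset.sum_congr rfl fun w _ => hp0 w] at h2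
      rw [hL₀, ← h2]
      exact hN
    · rw [hL₁ _ j hj, avgField_lin, map_sum]
      refine Finset.sum_eq_zero fun w _ => ?_
      rw [map_smul, map_mul, map_mul, map_pow, map_pow]
      by_cases hw : (w : V ≃ₗ[ℂ] V) v = v
      · have : (w : V ≃ₗ[ℂ] V)⁻¹ v = v :=
          mem_fixedSpace.1 (by rwa [fixedSpace_inv, mem_fixedSpace])
        rw [evalAt_actPoly _ v (lin V β), this, evalAt_lin, hβv, mul_zero, smul_zero]
      · rw [hf0 w hw, zero_pow two_ne_zero, zero_mul, smul_zero]
  -- fields along the hyperplane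
  have htangent : ∀ j, j ≠ i₀ → ∃ η, L η j ≠ 0 ∧ ∀ k, k ≠ i₀ → k ≠ j → L η k = 0 := by
    intro j hj
    -- The correction puts u in the kernel of β, where the stabilizer acts trivially, and leaves the
    -- coordinates other than i₀ equal to those of e j.
    let u := e j - (β (e j) / β (e i₀)) • e i₀
    have hu : u ∈ LinearMap.ker β := by
      rw [LinearMap.mem_ker, map_sub, map_smul, smul_eq_mul, div_mul_cancel₀ _ hi₀, sub_self]
    have hval : ∀ k, k ≠ i₀ → L (avgField W f u) k =
        (∑ w : W, (if (w : V ≃ₗ[ℂ] V) v = v then (1 : ℂ) else 0)) * (if k = j then 1 else 0) := by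
      intro k hk
      rw [hL₁ _ k hk, avgField_lin, map_sum, Finset.sum_mul]
      refine Finset.sum_congr rfl fun w _ => ?_
      rw [map_smul]
      by_cases hw : (w : V ≃ₗ[ℂ] V) v = v
      · rw [hf1 w hw, if_pos hw, mem_fixedSpace.1 (hstab w w.2 hw hu)]
        simp [u, Finsupp.single_apply, hk.symm, eq_comm]
      · rw [hf0 w hw, if_neg hw, smul_zero, zero_mul]
    refine ⟨avgField W f u, ?_, fun k hk hkj => ?_⟩
    · rw [hval j hj, if_pos rfl, mul_one]
      exact hN
    · rw [hval k hk, if_neg hkj, mul_zero]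
  have hspan : Submodule.span ℂ (Set.range L) = ⊤ := by
    obtain ⟨η₀, h₀, h₀'⟩ := hnormal
    have hs₀ : Pi.single i₀ (1 : ℂ) ∈ Submodule.span ℂ (Set.range L) := by
      have : Pi.single i₀ (1 : ℂ) = (L η₀ i₀)⁻¹ • L η₀ := by
        ext k
        by_cases hk : k = i₀
        · subst hk
          simp [h₀]
        · simp [hk, h₀' k hk]
      rw [this]
      exact Submodule.smul_mem _ _ (Submodule.subset_span ⟨_, rfl⟩)
    rw [eq_top_iff, ← (Pi.basisFun ℂ ι).span_eq, Submodule.span_le]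
    rintro _ ⟨j, rfl⟩
    rw [Pi.basisFun_apply]
    by_cases hj : j = i₀
    · rw [hj]
      exact hs₀
    · obtain ⟨η, h, h'⟩ := htangent j hj
      have : Pi.single j (1 : ℂ) = (L η j)⁻¹ • (L η - L η i₀ • Pi.single i₀ (1 : ℂ)) := by
        ext k
        by_cases hk : k = i₀
        · subst hk
          simp [Ne.symm hj]
        · by_cases hkj : k = j
          · subst hkj
            simp [h, hk]
          · simp [hk, hkj, h' k hk hkj]
      rw [this]
      exact Submodule.smul_mem _ _ (sub_mem (Submodule.subset_span ⟨_, rfl⟩)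
        (Submodule.smul_mem _ _ hs₀))
  -- A column operation puts θ i (β) = β * q (θ i) in column i₀ and multiplies the determinant by β
  -- (e i₀). Dividing by β leaves a matrix of determinant β (e i₀) * g, whose rows at v are the
  -- vectors L (θ i).
  have hcol : (fun i => ∑ j, algebraMap ℂ (PolyFun V) (β (e j)) • coeffMatrix e θ i j) =
      lin V β • fun i => q (θ i) := by
    funext i
    rw [Pi.smul_apply, smul_eq_mul, ← hq]
    conv_rhs => rw [hβsum, map_sum, map_sum]
    refine Finset.sum_congr rfl fun j _ => ?_
    rw [map_smul, Derivation.map_smul, smul_eq_mul, Algebra.smul_def]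
    rfl
  have hdet : ((coeffMatrix e θ).updateCol i₀ fun i => q (θ i)).det =
      algebraMap ℂ (PolyFun V) (β (e i₀)) * g := by
    apply mul_left_cancel₀ hb0
    rw [← Matrix.det_updateCol_smul, ← hcol, Matrix.det_updateCol_sum, hg, smul_eq_mul]
    ring
  have hne : evalAt v ((coeffMatrix e θ).updateCol i₀ fun i => q (θ i)).det ≠ 0 := by
    rw [AlgHom.map_det]
    refine det_ne_zero_of_span ?_
    have hrow : ((evalAt v).mapMatrix ((coeffMatrix e θ).updateCol i₀ fun i => q (θ i))).row =
        L ∘ θ := by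
      funext i j
      change evalAt v ((coeffMatrix e θ).updateCol i₀ (fun i => q (θ i)) i j) = L (θ i) j
      by_cases hj : j = i₀
      · rw [hj, Matrix.updateCol_self, hL₀]
      · rw [Matrix.updateCol_ne hj, hL₁ _ j hj]
        rfl
    rw [hrow]
    exact span_comp_basis L θ hspan
  rw [hdet, map_mul] at hne
  exact right_ne_zero_of_mul hne

/-- The coefficient matrix of a basis of invariant derivations has the product of the forms
defining the reflecting hyperplanes as its determinant, up to a constant. -/
theorem exists_det_coeffMatrix_eq (hW : IsUnitaryReflectionGroup W) {α : Submodule ℂ V → Dual ℂ V}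
    (hα : ∀ H ∈ hyperplanes W, LinearMap.ker (α H) = H) :
    ∃ c : ℂ, c ≠ 0 ∧
      (coeffMatrix e θ).det = algebraMap ℂ (PolyFun V) c * definingPoly W α := by
  classical
  have := hW.finite
  have := Fintype.ofFinite W
  obtain ⟨g, hg⟩ := definingPoly_dvd hα hW fun w hw => actPoly_det_coeffMatrix e θ hw
  -- The exceptional subspaces: fixed spaces of nontrivial elements that are not reflections, and
  -- intersections of two distinct reflecting hyperplanes.
  let s₁ : Finset (Submodule ℂ V) := Finset.image (fun w : W => fixedSpace (w : V ≃ₗ[ℂ] V))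
    (Finset.filter (fun w : W => w ≠ 1 ∧ ¬ IsReflection (w : V ≃ₗ[ℂ] V)) Finset.univ)
  let s₂ : Finset (Submodule ℂ V) := Finset.image
    (fun w : W × W => fixedSpace (w.1 : V ≃ₗ[ℂ] V) ⊓ fixedSpace (w.2 : V ≃ₗ[ℂ] V))
    (Finset.filter (fun w : W × W => IsReflection (w.1 : V ≃ₗ[ℂ] V) ∧
      IsReflection (w.2 : V ≃ₗ[ℂ] V) ∧
      fixedSpace (w.1 : V ≃ₗ[ℂ] V) ≠ fixedSpace (w.2 : V ≃ₗ[ℂ] V)) Finset.univ)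
  have hs : ∀ U ∈ s₁ ∪ s₂, finrank ℂ U + 2 ≤ finrank ℂ V := by
    intro U hU
    rcases Finset.mem_union.1 hU with hU | hU
    · obtain ⟨w, hw, rfl⟩ := Finset.mem_image.1 hU
      obtain ⟨hw1, hwr⟩ := (Finset.mem_filter.1 hw).2
      have hlt : finrank ℂ (fixedSpace (w : V ≃ₗ[ℂ] V)) < finrank ℂ V := by
        refine Submodule.finrank_lt fun h => hw1 (Subtype.ext (LinearEquiv.ext fun v => ?_))
        exact mem_fixedSpace.1 (h ▸ Submodule.mem_top)
      rw [IsReflection] at hwr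
      omega
    · obtain ⟨w, hw, rfl⟩ := Finset.mem_image.1 hU
      obtain ⟨h1, h2, hne⟩ := (Finset.mem_filter.1 hw).2
      have hlt : finrank ℂ ↥(fixedSpace (w.1 : V ≃ₗ[ℂ] V) ⊓ fixedSpace (w.2 : V ≃ₗ[ℂ] V)) <
          finrank ℂ (fixedSpace (w.1 : V ≃ₗ[ℂ] V)) := by
        refine Submodule.finrank_lt_finrank_of_lt (lt_of_le_of_ne inf_le_left fun h => hne ?_)
        refine Submodule.eq_of_le_of_finrank_eq (inf_eq_left.1 h) ?_
        rw [IsReflection] at h1 h2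
        omega
      rw [IsReflection] at h1
      omega
  obtain ⟨c, rfl⟩ := exists_eq_algebraMap_of_ne_zero (s₁ ∪ s₂) hs g (by
    intro v hv
    have hv₁ : ∀ w : W, (w : V ≃ₗ[ℂ] V) v = v → w = 1 ∨ IsReflection (w : V ≃ₗ[ℂ] V) := by
      intro w hw
      by_contra! h
      exact hv _ (Finset.mem_union_left _ (Finset.mem_image_of_mem _
        (Finset.mem_filter.2 ⟨Finset.mem_univ w, h⟩))) (mem_fixedSpace.2 hw)
    -- Off the exceptional subspaces the stabilizer of v is trivial, or consists of 1 and
    -- reflections sharing one hyperplane.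
    by_cases hex : ∃ w : W, IsReflection (w : V ≃ₗ[ℂ] V) ∧ (w : V ≃ₗ[ℂ] V) v = v
    · obtain ⟨w, hw, hwv⟩ := hex
      have hH : fixedSpace (w : V ≃ₗ[ℂ] V) ∈ hyperplanes W := ⟨w, w.2, hw, rfl⟩
      have hk := hα _ hH
      obtain ⟨q, hq⟩ := lin_dvd_definingPoly hW α hH
      rw [hq, mul_assoc] at hg
      -- q * g is the determinant divided by the form of this hyperplane, and it is this product
      -- that does not vanish at v.
      refine right_ne_zero_of_mul (a := evalAt v q) ?_
      rw [← map_mul]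
      refine evalAt_ne_zero_of_det_eq e θ (linearForm_ne_zero hα hH) ?_ (fun w' hw' hwv' => ?_)
        (fun η => ?_) hg
      · rw [← LinearMap.mem_ker, hk]
        exact mem_fixedSpace.2 hwv
      · rw [hk]
        rcases hv₁ ⟨w', hw'⟩ hwv' with h | h
        · intro u _
          rw [show w' = 1 from congrArg Subtype.val h]
          exact mem_fixedSpace.2 rfl
        · by_contra hle
          exact hv _ (Finset.mem_union_right _ (Finset.mem_image_of_mem _
            (Finset.mem_filter.2 ⟨Finset.mem_univ (w, (⟨w', hw'⟩ : W)), hw, h,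
              fun h => hle h.le⟩))) ⟨mem_fixedSpace.2 hwv, mem_fixedSpace.2 hwv'⟩
      -- An invariant derivation maps the form of the hyperplane to a polynomial that w multiplies
      -- by det⁻¹, as it does the form itself.
      · refine lin_dvd_of_semiinvariant hw (hW.isOfFinOrder w.2) hk ?_
        rw [← invDer_apply_actDual η w.2, actDual_of_ker_le (linearForm_ne_zero hα hH) hk.le,
          map_smul, Derivation.map_smul]
    · have hne := evalAt_det_ne_zero_of_trivial_stabilizer e θ (v := v) (fun w hw hwv => by
        rcases hv₁ ⟨w, hw⟩ hwv with h | h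
        · exact congrArg Subtype.val h
        · exact absurd ⟨⟨w, hw⟩, h, hwv⟩ hex)
      rw [hg, map_mul] at hne
      exact right_ne_zero_of_mul hne)
  refine ⟨c, ?_, by rw [hg, mul_comm]⟩
  rintro rfl
  obtain ⟨v, hv⟩ := exists_trivial_stabilizer W
  refine evalAt_det_ne_zero_of_trivial_stabilizer e θ hv ?_
  rw [hg, map_zero, mul_zero, map_zero]

end Values

end ReflForms
end

noncomputable section

namespace ReflForms

/-! ### Exterior powers and semilinear maps -/

section Semilinear

variable {A B M N : Type*} [CommRing A] [CommRing B] [AddCommGroup M] [Module A M]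
  [AddCommGroup N] [Module B N]

theorem extMap_ιMulti (σ : A →+* B) (f : M →ₛₗ[σ] N) (p : ℕ) (m : Fin p → M) :
    extMap σ f (ExteriorAlgebra.ιMulti A p m) = ExteriorAlgebra.ιMulti B p (fun i => f (m i)) := by
  rw [ExteriorAlgebra.ιMulti_apply, ExteriorAlgebra.ιMulti_apply, map_list_prod, List.map_ofFn]
  congr 2
  funext i
  exact extMap_ι σ f (m i)

theorem extMap_mem (σ : A →+* B) (f : M →ₛₗ[σ] N) (p : ℕ) {x : ExteriorAlgebra A M}
    (hx : x ∈ ⋀[A]^p M) : extMap σ f x ∈ ⋀[B]^p N := by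
  rw [← ExteriorAlgebra.ιMulti_span_fixedDegree] at hx
  induction hx using Submodule.span_induction with
  | mem x hx =>
    obtain ⟨m, rfl⟩ := hx
    rw [extMap_ιMulti, ← ExteriorAlgebra.ιMulti_span_fixedDegree]
    exact Submodule.subset_span ⟨_, rfl⟩
  | zero => rw [map_zero]; exact zero_mem _
  | add x y _ _ hx hy => rw [map_add]; exact add_mem hx hy
  | smul a x _ hx => rw [extMap_smul]; exact Submodule.smul_mem _ _ hx

/-- The map of exterior powers induced by a semilinear map. -/
def extPow (σ : A →+* B) (f : M →ₛₗ[σ] N) (p : ℕ) : ⋀[A]^p M →ₛₗ[σ] ⋀[B]^p N where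
  toFun x := ⟨extMap σ f x, extMap_mem σ f p x.2⟩
  map_add' _ _ := Subtype.ext (map_add _ _ _)
  map_smul' a x := Subtype.ext (extMap_smul σ f a x)

theorem extPow_ιMulti (σ : A →+* B) (f : M →ₛₗ[σ] N) (p : ℕ) (m : Fin p → M) :
    extPow σ f p (exteriorPower.ιMulti A p m) = exteriorPower.ιMulti B p (fun i => f (m i)) :=
  Subtype.ext (extMap_ιMulti σ f p m)

theorem exteriorPower_semilinear_ext {σ : A →+* B} {p : ℕ} {f g : ⋀[A]^p M →ₛₗ[σ] N}
    (h : ∀ m : Fin p → M, f (exteriorPower.ιMulti A p m) = g (exteriorPower.ιMulti A p m)) :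
    f = g := by
  refine LinearMap.ext_on (exteriorPower.ιMulti_span A p M) ?_
  rintro _ ⟨m, rfl⟩
  exact h m

theorem injective_of_linearIndependent {κ : Type*} {σ : A →+* B} (hσ : Function.Injective σ)
    (b : Basis κ A M) (f : M →ₛₗ[σ] N) (h : LinearIndependent B (f ∘ b)) :
    Function.Injective f := by
  rw [injective_iff_map_eq_zero]
  intro x hx
  rw [← b.linearCombination_repr x, Finsupp.linearCombination_apply, map_finsuppSum] at hx
  have h1 : Finsupp.linearCombination B (f ∘ b) ((b.repr x).mapRange σ (map_zero σ)) = 0 := by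
    rw [Finsupp.linearCombination_apply, Finsupp.sum_mapRange_index (by simp), ← hx]
    exact Finsupp.sum_congr fun i _ => (f.map_smulₛₗ _ _).symm
  have h2 := (linearIndependent_iff.1 h) _ h1
  apply b.repr.injective
  rw [map_zero]
  ext i
  apply hσ
  simpa using DFunLike.congr_fun h2 i

/-- An injective semilinear map whose image is spanned over the smaller ring by a family independent
over the larger one pulls this family back to a basis. -/
theorem exists_basis_of_image {ι : Type*} [Fintype ι] {σ : A →+* B} (hσ : Function.Injective σ)
    (f : M →ₛₗ[σ] N) (hf : Function.Injective f) {v : ι → N} (hv : LinearIndependent B v)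
    (hmem : ∀ i, ∃ m, f m = v i) (hspan : ∀ x, ∃ r : ι → A, f x = ∑ i, σ (r i) • v i) :
    ∃ b : Basis ι A M, ∀ i, f (b i) = v i := by
  choose m hm using hmem
  have hsum : ∀ r : ι → A, f (∑ i, r i • m i) = ∑ i, σ (r i) • v i := by
    intro r
    rw [map_sum]
    exact Finset.sum_congr rfl fun i _ => by rw [f.map_smulₛₗ, hm]
  have hli : LinearIndependent A m := by
    rw [Fintype.linearIndependent_iff] at hv ⊢
    intro g hg i
    apply hσ
    rw [map_zero]
    exact hv (fun i => σ (g i)) (by rw [← hsum, hg, map_zero]) i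
  refine ⟨Basis.mk hli fun x _ => ?_, fun i => by rw [Basis.mk_apply, hm]⟩
  obtain ⟨r, hr⟩ := hspan x
  rw [hf (hr.trans (hsum r).symm)]
  exact Submodule.sum_mem _ fun i _ => Submodule.smul_mem _ _ (Submodule.subset_span ⟨i, rfl⟩)

end Semilinear

/-! ### Bases of exterior powers -/

section ExteriorBasis

variable {A M ι : Type*} [CommRing A] [AddCommGroup M] [Module A M] [LinearOrder ι]

/-- The basis of an exterior power indexed by increasing families. -/
def extBasis (b : Basis ι A M) (p : ℕ) : Basis (Fin p ↪o ι) A (⋀[A]^p M) :=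
  (b.exteriorPower p).reindex Set.powersetCard.ofFinEmbEquiv.symm

theorem extBasis_apply (b : Basis ι A M) (p : ℕ) (I : Fin p ↪o ι) :
    extBasis b p I = exteriorPower.ιMulti A p (fun k => b (I k)) := by
  rw [extBasis, Basis.reindex_apply, exteriorPower.basis_apply]
  simp [exteriorPower.ιMulti_family, Function.comp_def]

theorem extBasis_repr_ιMulti (b : Basis ι A M) (p : ℕ) (I : Fin p ↪o ι) (m : Fin p → M) :
    (extBasis b p).repr (exteriorPower.ιMulti A p m) I =
      (Matrix.of fun i j => b.coord (I j) (m i)).det := by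
  rw [extBasis, Basis.repr_reindex_apply, exteriorPower.basis_repr_apply,
    exteriorPower.ιMultiDual_apply_ιMulti]
  simp

end ExteriorBasis

/-! ### Minors of the inverse matrix -/

/-- The matrix obtained by replacing the rows with indices `I i` by the vectors `v i`. -/
def replaceRows {A n : Type*} {p : ℕ} (P : Matrix n n A) (I : Fin p → n) (v : Fin p → n → A) :
    Matrix n n A :=
  Matrix.of (Function.extend I v P.row)

theorem replaceRows_apply {A n : Type*} {p : ℕ} (P : Matrix n n A) {I : Fin p → n}
    (hI : Function.Injective I)
    (v : Fin p → n → A) (i : Fin p) (s : n) : replaceRows P I v (I i) s = v i s :=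
  congrFun (hI.extend_apply v P.row i) s

theorem replaceRows_apply_of_notMem {A n : Type*} {p : ℕ} (P : Matrix n n A) {I : Fin p → n}
    (v : Fin p → n → A) {r : n} (hr : r ∉ Set.range I) (s : n) :
    replaceRows P I v r s = P r s :=
  congrFun (Function.extend_apply' v P.row r hr) s

section Minors

variable {A n : Type*} [CommRing A] [Fintype n] [DecidableEq n]

/-- The rows outside I are those of the identity, so the matrix is block triangular with an identity
block. -/
theorem det_replaceRows_one {p : ℕ} (N : Matrix n n A) (I J : Fin p → n)
    (hI : Function.Injective I) :
    (replaceRows (1 : Matrix n n A) I (fun i => N.row (J i))).det = (N.submatrix J I).det := by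
  classical
  rw [Matrix.twoBlockTriangular_det _ (· ∈ Set.range I)]
  · have h1 : (replaceRows (1 : Matrix n n A) I (fun i => N.row (J i))).toSquareBlockProp
        (fun r => r ∉ Set.range I) = 1 := by
      ext i j
      rw [Matrix.toSquareBlockProp_def, Matrix.of_apply, replaceRows_apply_of_notMem _ _ i.2,
        Matrix.one_apply, Matrix.one_apply]
      exact if_congr Subtype.coe_inj rfl rfl
    have h2 : ((replaceRows (1 : Matrix n n A) I (fun i => N.row (J i))).toSquareBlockProp
        (· ∈ Set.range I)).submatrix (Equiv.ofInjective I hI) (Equiv.ofInjective I hI) =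
        N.submatrix J I := by
      ext i j
      rw [Matrix.submatrix_apply, Matrix.toSquareBlockProp_def, Matrix.of_apply]
      exact replaceRows_apply (1 : Matrix n n A) hI (fun i => N.row (J i)) i (I j)
    rw [h1, Matrix.det_one, mul_one, ← h2, Matrix.det_submatrix_equiv_self]
    congr!
  · intro i hi j hj
    rw [replaceRows_apply_of_notMem _ _ hi, Matrix.one_apply_ne]
    rintro rfl
    exact hi hj

/-- A minor of the inverse of a matrix, times the determinant, is obtained by replacing rows by
standard vectors. -/
theorem det_mul_minor {p : ℕ} {P N : Matrix n n A} (hPN : P * N = 1) (I J : Fin p → n)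
    (hI : Function.Injective I) :
    P.det * (N.submatrix J I).det = (replaceRows P I (fun i => Pi.single (J i) 1)).det := by
  -- Right multiplication by N turns the kept rows of P into rows of the identity, and the standard
  -- vectors into rows of N.
  have hT : replaceRows P I (fun i => Pi.single (J i) 1) * N =
      replaceRows 1 I (fun i => N.row (J i)) := by
    ext r s
    rw [Matrix.mul_apply]
    by_cases hr : r ∈ Set.range I
    · obtain ⟨i, rfl⟩ := hr
      simp [replaceRows_apply _ hI, Pi.single_apply]
    · simp only [replaceRows_apply_of_notMem _ _ hr]
      rw [← hPN, Matrix.mul_apply]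
  have hdet : P.det * N.det = 1 := by rw [← Matrix.det_mul, hPN, Matrix.det_one]
  rw [← det_replaceRows_one N I J hI, ← hT, Matrix.det_mul, mul_left_comm, hdet, mul_one]

end Minors

end ReflForms
end

noncomputable section

namespace ReflForms

variable {V : Type*} [NormedAddCommGroup V] [InnerProductSpace ℂ V]
variable {W : Subgroup (V ≃ₗ[ℂ] V)}

attribute [local instance] invDerModule

/-! ### Coordinate forms -/

section Coordinates

variable {ι : Type*} [Fintype ι] [DecidableEq ι] (e : Basis ι ℂ V)

/-- The coordinate vector fields. -/
def derBasis : Basis ι (PolyFun V) (Der V) := Basis.ofEquivFun (derEquiv e.dualBasis)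

theorem derBasis_repr (θ : Der V) (j : ι) : (derBasis e).repr θ j = θ (lin V (e.coord j)) := by
  change (derBasis e).equivFun θ j = _
  rw [derBasis, Basis.equivFun_ofEquivFun, derEquiv_apply, Basis.coe_dualBasis]

/-- The differentials of the coordinates. -/
def formBasis : Basis ι (PolyFun V) (OneForm V) := (derBasis e).dualBasis

theorem formBasis_apply (j : ι) (θ : Der V) : formBasis e j θ = θ (lin V (e.coord j)) := by
  rw [formBasis, Basis.coe_dualBasis, Basis.coord_apply, derBasis_repr]

/-- The differentials of the coordinates as a basis of the rational forms. -/
def ratFormBasis : Basis ι (RatFun V) (RatOneForm V) :=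
  Basis.ofEquivFun ((derBasis e).constr (RatFun V)).symm

theorem ratFormBasis_repr (ω : RatOneForm V) (j : ι) :
    (ratFormBasis e).repr ω j = ω (derBasis e j) := by
  change (ratFormBasis e).equivFun ω j = _
  rw [ratFormBasis, Basis.equivFun_ofEquivFun]
  rfl

theorem ratFormBasis_apply (j : ι) : ratFormBasis e j = toRatOne (formBasis e j) := by
  apply (ratFormBasis e).repr.injective
  ext k
  rw [Basis.repr_self, ratFormBasis_repr]
  change _ = algebraMap (PolyFun V) (RatFun V) (formBasis e j (derBasis e k))
  rw [formBasis, Basis.coe_dualBasis, Basis.coord_apply, Basis.repr_self, Finsupp.single_apply,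
    Finsupp.single_apply]
  by_cases h : j = k
  · simp [h]
  · simp [h, Ne.symm h]

theorem rat_apply_eq_sum (ω : RatOneForm V) (θ : Der V) :
    ω θ = ∑ j, algebraMap (PolyFun V) (RatFun V) (θ (lin V (e.coord j))) * ω (derBasis e j) := by
  conv_lhs => rw [← (derBasis e).sum_repr θ, map_sum]
  refine Finset.sum_congr rfl fun j _ => ?_
  rw [map_smul, derBasis_repr, Algebra.smul_def]

end Coordinates

theorem algebraMap_ratFun_injective :
    Function.Injective (algebraMap (PolyFun V) (RatFun V)) := IsFractionRing.injective _ _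

theorem algebraMap_invariantRing_injective :
    Function.Injective (algebraMap (invariantRing W) (RatFun V)) := fun _ _ h =>
  Subtype.ext (algebraMap_ratFun_injective h)

/-! ### The dual basis of a basis of invariant derivations -/

section Dual

variable {ℓ : ℕ} (e : Basis (Fin ℓ) ℂ V) (θ : Fin ℓ → invDer W)

/-- The values of rational forms on a family of derivations. -/
def ratValues : RatOneForm V →ₗ[RatFun V] (Fin ℓ → RatFun V) where
  toFun ω i := ω (θ i)
  map_add' _ _ := rfl
  map_smul' _ _ := rfl

/-- The coefficient matrix over the field of rational functions. -/
abbrev ratMatrix : Matrix (Fin ℓ) (Fin ℓ) (RatFun V) :=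
  (coeffMatrix e θ).map (algebraMap (PolyFun V) (RatFun V))

theorem ratValues_eq_mulVec (ω : RatOneForm V) :
    ratValues θ ω = (ratMatrix e θ).mulVec fun j => ω (derBasis e j) :=
  funext fun i => rat_apply_eq_sum e ω (θ i)

variable (hdet : (coeffMatrix e θ).det ≠ 0)
include hdet

theorem isUnit_det_ratMatrix : IsUnit (ratMatrix e θ).det := by
  rw [isUnit_iff_ne_zero, ratMatrix, ← RingHom.mapMatrix_apply, ← RingHom.map_det]
  exact (map_ne_zero_iff _ algebraMap_ratFun_injective).2 hdet

/-- In coordinates the map is multiplication by a matrix of nonzero determinant. -/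
theorem ratValues_bijective : Function.Bijective (ratValues θ) := by
  have hu := isUnit_det_ratMatrix e θ hdet
  constructor
  · intro ω η h
    rw [ratValues_eq_mulVec e, ratValues_eq_mulVec e] at h
    have := Matrix.mulVec_injective_of_isUnit ((Matrix.isUnit_iff_isUnit_det _).2 hu) h
    apply (ratFormBasis e).repr.injective
    ext j
    rw [ratFormBasis_repr, ratFormBasis_repr]
    exact congrFun this j
  · intro c
    refine ⟨(derBasis e).constr (RatFun V) ((ratMatrix e θ)⁻¹.mulVec c), ?_⟩
    rw [ratValues_eq_mulVec e]
    simp only [Basis.constr_basis]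
    rw [Matrix.mulVec_mulVec, Matrix.mul_nonsing_inv _ hu, Matrix.one_mulVec]

/-- The basis of rational forms dual to a family of derivations. -/
def ratDualBasis : Basis (Fin ℓ) (RatFun V) (RatOneForm V) :=
  Basis.ofEquivFun (LinearEquiv.ofBijective (ratValues θ) (ratValues_bijective e θ hdet))

theorem ratDualBasis_repr (ω : RatOneForm V) (i : Fin ℓ) :
    (ratDualBasis e θ hdet).repr ω i = ω (θ i) := by
  change (ratDualBasis e θ hdet).equivFun ω i = _
  rw [ratDualBasis, Basis.equivFun_ofEquivFun]
  rfl

theorem isDualFamily_iff (ω : Fin ℓ → RatOneForm V) :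
    IsDualFamily (fun i => (θ i : Der V)) ω ↔ ω = ratDualBasis e θ hdet := by
  constructor
  · intro h
    funext j
    apply (ratDualBasis e θ hdet).repr.injective
    ext i
    rw [ratDualBasis_repr, Basis.repr_self, h i j, Finsupp.single_apply]
    exact if_congr eq_comm rfl rfl
  · rintro rfl i j
    rw [← ratDualBasis_repr e θ hdet, Basis.repr_self, Finsupp.single_apply]
    exact if_congr eq_comm rfl rfl

end Dual

end ReflForms
end

noncomputable section

namespace ReflForms

variable {V : Type*} [NormedAddCommGroup V] [InnerProductSpace ℂ V]
variable {W : Subgroup (V ≃ₗ[ℂ] V)}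

attribute [local instance] invDerModule

/-! ### Rational forms of higher degree -/

theorem actOneForm_apply_invDer {w : V ≃ₗ[ℂ] V} (hw : w ∈ W) (ω : OneForm V) (θ : invDer W) :
    actOneForm w ω (θ : Der V) = actPoly w (ω θ) := by
  change actPoly w (ω (actDer w⁻¹ (θ : Der V))) = _
  rw [θ.2 _ (W.inv_mem hw)]

/-- Polynomial forms of degree `p` as rational forms. -/
abbrev toRatPow (p : ℕ) :
    ⋀[PolyFun V]^p (OneForm V) →ₛₗ[algebraMap (PolyFun V) (RatFun V)]
      ⋀[RatFun V]^p (RatOneForm V) :=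
  extPow (algebraMap (PolyFun V) (RatFun V)) toRatOne p

/-- The action of the general linear group on polynomial forms of degree `p`. -/
abbrev actPow (w : V ≃ₗ[ℂ] V) (p : ℕ) :
    ⋀[PolyFun V]^p (OneForm V) →ₛₗ[(actPoly w : PolyFun V →+* PolyFun V)]
      ⋀[PolyFun V]^p (OneForm V) :=
  extPow (actPoly w : PolyFun V →+* PolyFun V) (actOneForm w) p

/-- A ring homomorphism as a semilinear map. -/
def semilinearOf {A B : Type*} [CommRing A] [CommRing B] (σ : A →+* B) : A →ₛₗ[σ] B where
  toFun := σ
  map_add' := map_add σ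
  map_smul' a b := map_mul σ a b

theorem semilinearOf_apply {A B : Type*} [CommRing A] [CommRing B] (σ : A →+* B) (a : A) :
    semilinearOf σ a = σ a := rfl

/-! ### Values of p-forms on invariant derivations -/

section Evaluation

variable {ℓ : ℕ} (θ : Fin ℓ → invDer W) (p : ℕ)

/-- The value of forms of degree `p` on the derivations with indices in `I`. -/
def formValue (I : Fin p ↪o Fin ℓ) : ⋀[PolyFun V]^p (OneForm V) →ₗ[PolyFun V] PolyFun V :=
  (exteriorPower.pairingDual (PolyFun V) (Der V) p).flip
    (exteriorPower.ιMulti (PolyFun V) p fun k => (θ (I k) : Der V))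

theorem formValue_ιMulti (I : Fin p ↪o Fin ℓ) (m : Fin p → OneForm V) :
    formValue θ p I (exteriorPower.ιMulti (PolyFun V) p m) =
      (Matrix.of fun i j => m i (θ (I j))).det := by
  rw [formValue, LinearMap.flip_apply, exteriorPower.pairingDual_ιMulti_ιMulti,
    ← Matrix.det_transpose]
  rfl

/-- Invariant derivations do not see the action, so w can be taken out of the determinant of values.
This reduces anti-invariance of forms to semi-invariance of polynomials. -/
theorem formValue_actPow {w : V ≃ₗ[ℂ] V} (hw : w ∈ W) (I : Fin p ↪o Fin ℓ)
    (x : ⋀[PolyFun V]^p (OneForm V)) :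
    formValue θ p I (actPow w p x) = actPoly w (formValue θ p I x) := by
  have : (formValue θ p I).comp (actPow w p) =
      (semilinearOf (actPoly w : PolyFun V →+* PolyFun V)).comp (formValue θ p I) := by
    refine exteriorPower_semilinear_ext fun m => ?_
    rw [LinearMap.comp_apply, LinearMap.comp_apply, extPow_ιMulti, formValue_ιMulti,
      formValue_ιMulti, semilinearOf_apply, RingHom.map_det]
    refine congrArg Matrix.det (Matrix.ext fun i j => ?_)
    exact actOneForm_apply_invDer hw (m i) (θ (I j))
  exact LinearMap.congr_fun this x

variable (e : Basis (Fin ℓ) ℂ V) (hdet : (coeffMatrix e θ).det ≠ 0)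

/-- On a decomposable form both sides are the determinant of the values of its factors on the chosen
derivations. In particular these coordinates are polynomials. -/
theorem repr_toRatPow (I : Fin p ↪o Fin ℓ) (x : ⋀[PolyFun V]^p (OneForm V)) :
    (extBasis (ratDualBasis e θ hdet) p).repr (toRatPow p x) I =
      algebraMap (PolyFun V) (RatFun V) (formValue θ p I x) := by
  have : ((extBasis (ratDualBasis e θ hdet) p).coord I).comp (toRatPow p) =
      (semilinearOf (algebraMap (PolyFun V) (RatFun V))).comp (formValue θ p I) := by
    refine exteriorPower_semilinear_ext fun m => ?_
    rw [LinearMap.comp_apply, LinearMap.comp_apply, extPow_ιMulti, formValue_ιMulti,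
      Basis.coord_apply, extBasis_repr_ιMulti, semilinearOf_apply, RingHom.map_det]
    refine congrArg Matrix.det (Matrix.ext fun i j => ?_)
    rw [Matrix.of_apply, Basis.coord_apply, ratDualBasis_repr]
    rfl
  exact LinearMap.congr_fun this x

include e in
theorem toRatPow_extBasis (J : Fin p ↪o Fin ℓ) :
    toRatPow p (extBasis (formBasis e) p J) = extBasis (ratFormBasis e) p J := by
  rw [extBasis_apply, extBasis_apply, extPow_ιMulti]
  simp only [ratFormBasis_apply]

include e in
theorem toRatPow_injective : Function.Injective (toRatPow (V := V) p) := by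
  refine injective_of_linearIndependent algebraMap_ratFun_injective (extBasis (formBasis e) p) _ ?_
  have : toRatPow p ∘ extBasis (formBasis e) p = extBasis (ratFormBasis e) p :=
    funext fun J => toRatPow_extBasis p e J
  rw [this]
  exact Basis.linearIndependent _

/-- The form dual to a family of derivations has denominator at most the determinant of the
coefficient matrix. -/
theorem exists_toRatPow_eq (I : Fin p ↪o Fin ℓ) :
    ∃ x : ⋀[PolyFun V]^p (OneForm V), toRatPow p x =
      algebraMap (PolyFun V) (RatFun V) (coeffMatrix e θ).det •
        extBasis (ratDualBasis e θ hdet) p I := by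
  classical
  let N : Matrix (Fin ℓ) (Fin ℓ) (RatFun V) :=
    Matrix.of fun k j => ratDualBasis e θ hdet j (derBasis e k)
  have hN : ratMatrix e θ * N = 1 := by
    ext i j
    rw [Matrix.mul_apply]
    refine (rat_apply_eq_sum e (ratDualBasis e θ hdet j) (θ i)).symm.trans ?_
    rw [← ratDualBasis_repr e θ hdet, Basis.repr_self, Finsupp.single_apply, Matrix.one_apply]
    exact if_congr eq_comm rfl rfl
  -- The coordinates of the dual form are minors of the inverse matrix N; `det_mul_minor` writes
  -- their products with the determinant as determinants of polynomial matrices.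
  refine ⟨∑ J : Fin p ↪o Fin ℓ, (replaceRows (coeffMatrix e θ) I fun i => Pi.single (J i) 1).det •
    extBasis (formBasis e) p J, ?_⟩
  rw [map_sum, ← (extBasis (ratFormBasis e) p).sum_repr (extBasis (ratDualBasis e θ hdet) p I),
    Finset.smul_sum]
  refine Finset.sum_congr rfl fun J _ => ?_
  rw [LinearMap.map_smulₛₗ, toRatPow_extBasis, smul_smul]
  congr 1
  rw [extBasis_apply (ratDualBasis e θ hdet), extBasis_repr_ιMulti]
  have h1 : (Matrix.of fun i j => (ratFormBasis e).coord (J j) (ratDualBasis e θ hdet (I i))) =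
      (N.submatrix J I).transpose := by
    ext i j
    rw [Matrix.of_apply, Basis.coord_apply, ratFormBasis_repr]
    rfl
  rw [h1, Matrix.det_transpose, RingHom.map_det (algebraMap (PolyFun V) (RatFun V))
    (coeffMatrix e θ), RingHom.mapMatrix_apply, det_mul_minor hN I J I.injective, RingHom.map_det]
  congr 1
  ext r s
  rw [RingHom.mapMatrix_apply, Matrix.map_apply]
  by_cases hr : r ∈ Set.range I
  · obtain ⟨i, rfl⟩ := hr
    rw [replaceRows_apply _ I.injective, replaceRows_apply _ I.injective, Pi.single_apply,
      Pi.single_apply]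
    split_ifs <;> simp
  · rw [replaceRows_apply_of_notMem _ _ hr, replaceRows_apply_of_notMem _ _ hr, ratMatrix,
      Matrix.map_apply]

end Evaluation

end ReflForms
end

noncomputable section

namespace ReflForms

variable {V : Type*} [NormedAddCommGroup V] [InnerProductSpace ℂ V]
variable {W : Subgroup (V ≃ₗ[ℂ] V)}

attribute [local instance] invDerModule

/-! ### Anti-invariant forms -/

theorem smul_linearIndependent {K N κ : Type*} [Field K] [AddCommGroup N] [Module K N]
    (b : Basis κ K N) {q : K} (hq : q ≠ 0) : LinearIndependent K (fun i => q • b i) :=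
  b.linearIndependent.units_smul fun _ => Units.mk0 q hq

section

variable [FiniteDimensional ℂ V] {ℓ : ℕ} (hW : IsUnitaryReflectionGroup W)
  {α : Submodule ℂ V → Dual ℂ V} (hα : ∀ H ∈ hyperplanes W, LinearMap.ker (α H) = H)
  (e : Basis (Fin ℓ) ℂ V) (θ : Basis (Fin ℓ) (invariantRing W) (invDer W))
include hW hα

theorem det_coeffMatrix_ne_zero : (coeffMatrix e θ).det ≠ 0 := by
  obtain ⟨c, hc, h⟩ := exists_det_coeffMatrix_eq e θ hW hα
  rw [h]
  exact mul_ne_zero ((map_ne_zero_iff _ (algebraMap ℂ (PolyFun V)).injective).2 hc)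
    (definingPoly_ne_zero hα hW)

-- Up to a nonzero constant Q is the determinant of the coefficient matrix, which is known to be
-- semi-invariant.
include e θ in
theorem actPoly_definingPoly {w : V ≃ₗ[ℂ] V} (hw : w ∈ W) :
    actPoly w (definingPoly W α) = detInv w • definingPoly W α := by
  obtain ⟨c, hc, h⟩ := exists_det_coeffMatrix_eq e θ hW hα
  have h1 := actPoly_det_coeffMatrix e θ hw
  rw [h, map_mul, AlgHom.commutes, ← mul_smul_comm] at h1
  exact mul_left_cancel₀ ((map_ne_zero_iff _ (algebraMap ℂ (PolyFun V)).injective).2 hc) h1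

include e θ in
/-- Semi-invariants for the inverse determinant are invariant multiples of the product of the forms
defining the reflecting hyperplanes. -/
theorem exists_eq_mul_definingPoly {f : PolyFun V} (hf : ∀ w ∈ W, actPoly w f = detInv w • f) :
    ∃ r : invariantRing W, f = (r : PolyFun V) * definingPoly W α := by
  obtain ⟨r, rfl⟩ := definingPoly_dvd hα hW hf
  refine ⟨⟨r, fun w hw => ?_⟩, mul_comm _ _⟩
  have h := hf w hw
  rw [map_mul, actPoly_definingPoly hW hα e θ hw, smul_mul_assoc] at h
  exact mul_left_cancel₀ (definingPoly_ne_zero hα hW)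
    (smul_right_injective _ (detInv_ne_zero w) h)

-- Cramer's rule: a column of the adjugate, divided by the constant c with det = c Q, gives the
-- coefficients of the polynomial form Q ω_j.
include e in
theorem exists_form_apply_eq (j : Fin ℓ) :
    ∃ ω : OneForm V, ∀ i, ω (θ i : Der V) = if i = j then definingPoly W α else 0 := by
  obtain ⟨c, hc, h⟩ := exists_det_coeffMatrix_eq e θ hW hα
  refine ⟨∑ k, (algebraMap ℂ (PolyFun V) c⁻¹ * (coeffMatrix e θ).adjugate k j) • formBasis e k,
    fun i => ?_⟩
  have h1 := congrFun (congrFun (coeffMatrix e θ).mul_adjugate i) j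
  rw [Matrix.mul_apply, Matrix.smul_apply, Matrix.one_apply, h] at h1
  rw [LinearMap.sum_apply]
  have h2 : ∀ k, ((algebraMap ℂ (PolyFun V) c⁻¹ * (coeffMatrix e θ).adjugate k j) •
      formBasis e k) (θ i : Der V) = algebraMap ℂ (PolyFun V) c⁻¹ *
        (coeffMatrix e θ i k * (coeffMatrix e θ).adjugate k j) := by
    intro k
    rw [LinearMap.smul_apply, formBasis_apply, smul_eq_mul, mul_assoc,
      mul_comm (coeffMatrix e θ i k)]
    rfl
  simp only [h2]
  rw [← Finset.mul_sum, h1, smul_eq_mul, mul_assoc, ← mul_assoc, ← map_mul, inv_mul_cancel₀ hc,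
    map_one, one_mul, mul_ite, mul_one, mul_zero]

/-- The basis of the rational forms dual to a basis of the invariant derivations. -/
abbrev dualForms : Basis (Fin ℓ) (RatFun V) (RatOneForm V) :=
  ratDualBasis e θ (det_coeffMatrix_ne_zero hW hα e θ)

theorem toRatOne_eq_sum (ω : OneForm V) : toRatOne ω =
    ∑ i, algebraMap (PolyFun V) (RatFun V) (ω (θ i : Der V)) • dualForms hW hα e θ i := by
  conv_lhs => rw [← (dualForms hW hα e θ).sum_repr (toRatOne ω)]
  refine Finset.sum_congr rfl fun i _ => ?_
  rw [ratDualBasis_repr]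
  rfl

include e in
theorem oneForm_ext {ω η : OneForm V} (h : ∀ i, ω (θ i : Der V) = η (θ i : Der V)) : ω = η := by
  have h1 : toRatOne ω = toRatOne η := by
    rw [toRatOne_eq_sum hW hα e θ, toRatOne_eq_sum hW hα e θ]
    simp only [h]
  ext ξ
  exact algebraMap_ratFun_injective (LinearMap.congr_fun h1 ξ)

omit [FiniteDimensional ℂ V] hW hα in
theorem antiInvOneToRat_injective : Function.Injective (antiInvOneToRat W) := by
  intro ω η h
  apply Subtype.ext
  ext ξ
  exact algebraMap_ratFun_injective (LinearMap.congr_fun h ξ)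

/-- A basis of the anti-invariant `1`-forms. -/
theorem exists_basis_antiInvOne :
    ∃ b : Basis (Fin ℓ) (invariantRing W) (antiInvOne W), ∀ j, antiInvOneToRat W (b j) =
      algebraMap (PolyFun V) (RatFun V) (definingPoly W α) • dualForms hW hα e θ j := by
  choose η hη using exists_form_apply_eq hW hα e θ
  have hmem : ∀ j, η j ∈ antiInvOne W := by
    intro j w hw
    refine oneForm_ext hW hα e θ fun i => ?_
    rw [actOneForm_apply_invDer hw, LinearMap.smul_apply, hη]
    split_ifs
    · exact actPoly_definingPoly hW hα e θ hw
    · rw [map_zero, smul_zero]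
  have hrat : ∀ j, antiInvOneToRat W ⟨η j, hmem j⟩ =
      algebraMap (PolyFun V) (RatFun V) (definingPoly W α) • dualForms hW hα e θ j := by
    intro j
    refine (toRatOne_eq_sum hW hα e θ (η j)).trans ?_
    simp only [hη]
    rw [Finset.sum_eq_single j]
    · rw [if_pos rfl]
    · intro i _ hij
      rw [if_neg hij, map_zero, zero_smul]
    · exact fun h => absurd (Finset.mem_univ _) h
  have hQ : algebraMap (PolyFun V) (RatFun V) (definingPoly W α) ≠ 0 :=
    (map_ne_zero_iff _ algebraMap_ratFun_injective).2 (definingPoly_ne_zero hα hW)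
  refine exists_basis_of_image (M := antiInvOne W) algebraMap_invariantRing_injective
    (antiInvOneToRat W) antiInvOneToRat_injective (smul_linearIndependent _ hQ)
    (fun j => ⟨_, hrat j⟩) fun ω => ?_
  -- The coordinates of ω are its values on invariant derivations, which inherit semi-invariance and
  -- so are invariant multiples of Q.
  have hsemi : ∀ i, ∃ r : invariantRing W,
      (ω : OneForm V) (θ i : Der V) = (r : PolyFun V) * definingPoly W α := by
    intro i
    refine exists_eq_mul_definingPoly hW hα e θ fun w hw => ?_
    rw [← actOneForm_apply_invDer hw, ω.2 w hw, LinearMap.smul_apply]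
  choose r hr using hsemi
  refine ⟨r, (toRatOne_eq_sum hW hα e θ ω).trans (Finset.sum_congr rfl fun i _ => ?_)⟩
  rw [smul_smul, hr, map_mul]
  rfl

/-- Anti-invariant forms of degree `p` as rational forms. -/
def antiInvToRat (W : Subgroup (V ≃ₗ[ℂ] V)) (p : ℕ) :
    antiInv W p →ₛₗ[algebraMap (invariantRing W) (RatFun V)] ⋀[RatFun V]^p (RatOneForm V) where
  toFun x := toRatPow p ⟨x, x.2.1⟩
  map_add' x y := map_add (toRatPow p) ⟨(x : Form V), x.2.1⟩ ⟨(y : Form V), y.2.1⟩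
  map_smul' r x := by
    have h : ((r • x : antiInv W p) : Form V) = (r : PolyFun V) • (x : Form V) := by
      change r • (x : Form V) = _
      rw [← algebraMap_smul (PolyFun V) r (x : Form V)]
      rfl
    have h' : (⟨((r • x : antiInv W p) : Form V), (r • x).2.1⟩ : ⋀[PolyFun V]^p (OneForm V)) =
        (r : PolyFun V) • ⟨(x : Form V), x.2.1⟩ := Subtype.ext h
    refine Eq.trans (congrArg (toRatPow p) h') ?_
    exact (toRatPow p).map_smulₛₗ (r : PolyFun V) ⟨(x : Form V), x.2.1⟩

omit [FiniteDimensional ℂ V] hW hα in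
include e in
theorem antiInvToRat_injective (p : ℕ) : Function.Injective (antiInvToRat W p) := by
  intro x y h
  have h1 : (⟨(x : Form V), x.2.1⟩ : ⋀[PolyFun V]^p (OneForm V)) = ⟨(y : Form V), y.2.1⟩ :=
    toRatPow_injective p e h
  exact Subtype.ext (Subtype.mk.inj h1)

omit [FiniteDimensional ℂ V] hW hα in
theorem mem_antiInv_iff {p : ℕ} (x : ⋀[PolyFun V]^p (OneForm V)) :
    (x : Form V) ∈ antiInv W p ↔
      ∀ w ∈ W, actPow w p x = algebraMap ℂ (PolyFun V) (detInv w) • x := by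
  have h : ∀ w : V ≃ₗ[ℂ] V, actPow w p x = algebraMap ℂ (PolyFun V) (detInv w) • x ↔
      actForm w (x : Form V) = detInv w • (x : Form V) := by
    intro w
    rw [Subtype.ext_iff, ← algebraMap_smul (PolyFun V) (detInv w) (x : Form V)]
    rfl
  simp only [h]
  exact ⟨fun hx => hx.2, fun hx => ⟨x.2, hx⟩⟩

-- The values on the θ_I are the coordinates in a basis, so they determine the form, and taking them
-- commutes with W.
include hW hα e in
theorem mem_antiInv_iff_formValue {p : ℕ} (x : ⋀[PolyFun V]^p (OneForm V)) :
    (x : Form V) ∈ antiInv W p ↔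
      ∀ w ∈ W, ∀ I, actPoly w (formValue θ p I x) = detInv w • formValue θ p I x := by
  rw [mem_antiInv_iff]
  refine forall₂_congr fun w hw => ?_
  have h : ∀ I, formValue θ p I (actPow w p x) =
      formValue θ p I (algebraMap ℂ (PolyFun V) (detInv w) • x) ↔
      actPoly w (formValue θ p I x) = detInv w • formValue θ p I x := by
    intro I
    rw [formValue_actPow _ _ hw, map_smul, algebraMap_smul]
  simp only [← h]
  refine ⟨fun hx I => by rw [hx], fun hx => toRatPow_injective p e ?_⟩
  apply (extBasis (dualForms hW hα e θ) p).repr.injective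
  ext I
  rw [repr_toRatPow, repr_toRatPow, hx I]

/-- Rescaling by c⁻¹ turns the denominator det M into Q. The values of the resulting polynomial form
are Q or 0, and both are semi-invariant. -/
theorem exists_antiInvToRat_eq (p : ℕ) (I : Fin p ↪o Fin ℓ) :
    ∃ x : antiInv W p, antiInvToRat W p x =
      algebraMap (PolyFun V) (RatFun V) (definingPoly W α) •
        extBasis (dualForms hW hα e θ) p I := by
  obtain ⟨c, hc, h⟩ := exists_det_coeffMatrix_eq e θ hW hα
  obtain ⟨x, hx⟩ := exists_toRatPow_eq θ p e (det_coeffMatrix_ne_zero hW hα e θ) I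
  obtain ⟨y, hy⟩ : ∃ y, toRatPow p y = algebraMap (PolyFun V) (RatFun V) (definingPoly W α) •
      extBasis (dualForms hW hα e θ) p I := by
    refine ⟨algebraMap ℂ (PolyFun V) c⁻¹ • x, ?_⟩
    rw [LinearMap.map_smulₛₗ, hx, smul_smul, ← map_mul, h, ← mul_assoc, ← map_mul,
      inv_mul_cancel₀ hc, map_one, one_mul]
  refine ⟨⟨y, (mem_antiInv_iff_formValue hW hα e θ y).2 fun w hw K => ?_⟩, hy⟩
  have hval : formValue θ p K y = if I = K then definingPoly W α else 0 := by
    apply algebraMap_ratFun_injective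
    rw [← repr_toRatPow θ p e (det_coeffMatrix_ne_zero hW hα e θ), hy, map_smul,
      Finsupp.smul_apply, Basis.repr_self, Finsupp.single_apply]
    split_ifs <;> simp
  rw [hval]
  split_ifs
  · exact actPoly_definingPoly hW hα e θ hw
  · rw [map_zero, smul_zero]

theorem antiInvToRat_eq_sum (p : ℕ) (ω : antiInv W p) :
    ∃ r : (Fin p ↪o Fin ℓ) → invariantRing W, antiInvToRat W p ω =
      ∑ I, algebraMap (invariantRing W) (RatFun V) (r I) •
        algebraMap (PolyFun V) (RatFun V) (definingPoly W α) •
          extBasis (dualForms hW hα e θ) p I := by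
  have hω := (mem_antiInv_iff_formValue hW hα e θ ⟨(ω : Form V), ω.2.1⟩).1 ω.2
  have hsemi : ∀ I, ∃ r : invariantRing W,
      formValue θ p I ⟨(ω : Form V), ω.2.1⟩ = (r : PolyFun V) * definingPoly W α :=
    fun I => exists_eq_mul_definingPoly hW hα e θ fun w hw => hω w hw I
  choose r hr using hsemi
  refine ⟨r, ?_⟩
  rw [← (extBasis (dualForms hW hα e θ) p).sum_repr (antiInvToRat W p ω)]
  refine Finset.sum_congr rfl fun I _ => ?_
  rw [smul_smul]
  congr 1
  refine (repr_toRatPow θ p e _ I _).trans ?_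
  rw [hr, map_mul]
  rfl

/-- A basis of the anti-invariant `p`-forms. -/
theorem exists_basis_antiInv (p : ℕ) :
    ∃ b : Basis (Fin p ↪o Fin ℓ) (invariantRing W) (antiInv W p), ∀ I, antiInvToRat W p (b I) =
      algebraMap (PolyFun V) (RatFun V) (definingPoly W α) •
        extBasis (dualForms hW hα e θ) p I := by
  have hQ : algebraMap (PolyFun V) (RatFun V) (definingPoly W α) ≠ 0 :=
    (map_ne_zero_iff _ algebraMap_ratFun_injective).2 (definingPoly_ne_zero hα hW)
  exact exists_basis_of_image (M := antiInv W p) algebraMap_invariantRing_injective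
    (antiInvToRat W p) (antiInvToRat_injective e p) (smul_linearIndependent _ hQ)
    (exists_antiInvToRat_eq hW hα e θ p) (antiInvToRat_eq_sum hW hα e θ p)

end

end ReflForms
end

noncomputable section

namespace ReflForms

variable {V : Type*} [NormedAddCommGroup V] [InnerProductSpace ℂ V]
variable {W : Subgroup (V ≃ₗ[ℂ] V)}

attribute [local instance] invDerModule

/-! ### Comparison with the exterior powers over the invariants -/

theorem zpow_one_sub_smul_pow_smul {K N : Type*} [Field K] [AddCommGroup N] [Module K N] {q : K}
    (hq : q ≠ 0) (p : ℕ) (x : N) : q ^ (1 - (p : ℤ)) • q ^ p • x = q • x := by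
  rw [smul_smul, ← zpow_natCast, ← zpow_add₀ hq, sub_add_cancel, zpow_one]

theorem exists_eq_of_basis {A B M M' N κ : Type*} [CommRing A] [CommRing B] [AddCommGroup M]
    [Module A M] [AddCommGroup M'] [Module A M'] [AddCommGroup N] [Module B N] {σ : A →+* B}
    (f : M →ₛₗ[σ] N) (g : M' →ₛₗ[σ] N) (b : Basis κ A M) (c : Basis κ A M')
    (h : ∀ i, f (b i) = g (c i)) (x : M) : ∃ y, g y = f x := by
  have h1 : g.comp (b.equiv c (Equiv.refl κ) : M →ₗ[A] M') = f :=
    b.ext fun i => by simp [h]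
  exact ⟨b.equiv c (Equiv.refl κ) x, LinearMap.congr_fun h1 x⟩

/-- The natural map from the exterior power over the invariants of the module of anti-invariant
`1`-forms to the rational forms. -/
abbrev wedgePow (W : Subgroup (V ≃ₗ[ℂ] V)) (p : ℕ) :
    ⋀[invariantRing W]^p (antiInvOne W) →ₛₗ[algebraMap (invariantRing W) (RatFun V)]
      ⋀[RatFun V]^p (RatOneForm V) :=
  extPow (M := antiInvOne W) (N := RatOneForm V) (algebraMap (invariantRing W) (RatFun V))
    (antiInvOneToRat W) p

section

variable [FiniteDimensional ℂ V] {ℓ : ℕ} (hW : IsUnitaryReflectionGroup W)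
  {α : Submodule ℂ V → Dual ℂ V} (hα : ∀ H ∈ hyperplanes W, LinearMap.ker (α H) = H)
  (e : Basis (Fin ℓ) ℂ V) (θ : Basis (Fin ℓ) (invariantRing W) (invDer W))
include hW hα

/-- A basis of the exterior power over the invariants of the module of anti-invariant `1`-forms. -/
theorem exists_basis_exteriorPower_antiInvOne (p : ℕ) :
    ∃ c : Basis (Fin p ↪o Fin ℓ) (invariantRing W) (⋀[invariantRing W]^p (antiInvOne W)),
      ∀ I, wedgePow W p (c I) =
        algebraMap (PolyFun V) (RatFun V) (definingPoly W α) ^ p •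
          extBasis (dualForms hW hα e θ) p I := by
  obtain ⟨b, hb⟩ := exists_basis_antiInvOne hW hα e θ
  refine ⟨extBasis b p, fun I => ?_⟩
  rw [extBasis_apply, extPow_ιMulti, extBasis_apply]
  simp only [hb]
  rw [AlternatingMap.map_smul_univ, Finset.prod_const, Finset.card_univ, Fintype.card_fin]

-- The natural map carries an R-basis to nonzero multiples of a basis over the field of rational
-- functions.
include e θ in
theorem injOn_wedge (p : ℕ) : Set.InjOn (wedge W) (⋀[invariantRing W]^p (antiInvOne W)) := by
  obtain ⟨c, hc⟩ := exists_basis_exteriorPower_antiInvOne hW hα e θ p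
  have hQ : algebraMap (PolyFun V) (RatFun V) (definingPoly W α) ≠ 0 :=
    (map_ne_zero_iff _ algebraMap_ratFun_injective).2 (definingPoly_ne_zero hα hW)
  have hinj : Function.Injective (wedgePow W p) := by
    refine injective_of_linearIndependent algebraMap_invariantRing_injective c _ ?_
    have h : wedgePow W p ∘ c =
        fun I => algebraMap (PolyFun V) (RatFun V) (definingPoly W α) ^ p •
          extBasis (dualForms hW hα e θ) p I := funext hc
    rw [h]
    exact smul_linearIndependent _ (pow_ne_zero p hQ)
  intro x hx y hy h
  exact congrArg Subtype.val (@hinj ⟨x, hx⟩ ⟨y, hy⟩ (Subtype.ext h))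

/-- Bases of both sides with the same images in the rational forms. -/
theorem exists_bases (p : ℕ) :
    ∃ (b : Basis (Fin p ↪o Fin ℓ) (invariantRing W) (antiInv W p))
      (c : Basis (Fin p ↪o Fin ℓ) (invariantRing W) (⋀[invariantRing W]^p (antiInvOne W))),
      ∀ I : Fin p ↪o Fin ℓ,
        toRat (b I : Form V) = algebraMap (PolyFun V) (RatFun V) (definingPoly W α) •
          ExteriorAlgebra.ιMulti (RatFun V) p (fun k => dualForms hW hα e θ (I k)) ∧
        algebraMap (PolyFun V) (RatFun V) (definingPoly W α) ^ (1 - (p : ℤ)) • wedge W (c I) =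
          algebraMap (PolyFun V) (RatFun V) (definingPoly W α) •
            ExteriorAlgebra.ιMulti (RatFun V) p (fun k => dualForms hW hα e θ (I k)) := by
  obtain ⟨b, hb⟩ := exists_basis_antiInv hW hα e θ p
  obtain ⟨c, hc⟩ := exists_basis_exteriorPower_antiInvOne hW hα e θ p
  have hQ : algebraMap (PolyFun V) (RatFun V) (definingPoly W α) ≠ 0 :=
    (map_ne_zero_iff _ algebraMap_ratFun_injective).2 (definingPoly_ne_zero hα hW)
  refine ⟨b, c, fun I => ⟨?_, ?_⟩⟩
  · have h := congrArg Subtype.val (hb I)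
    rw [extBasis_apply] at h
    exact h
  · have h := congrArg Subtype.val (hc I)
    rw [extBasis_apply] at h
    rw [← zpow_one_sub_smul_pow_smul hQ p]
    exact congrArg _ h

-- Q^(1-p) times Q^p ω_I is Q ω_I, so suitable R-bases of the two sides have the same images; for p
-- = 0 both sides are R Q.
include e θ in
theorem image_antiInv (p : ℕ) : toRat '' (antiInv W p : Set (Form V)) =
    algebraMap (PolyFun V) (RatFun V) (definingPoly W α) ^ (1 - (p : ℤ)) •
      (wedge W '' (⋀[invariantRing W]^p (antiInvOne W))) := by
  obtain ⟨b, hb⟩ := exists_basis_antiInv hW hα e θ p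
  obtain ⟨c, hc⟩ := exists_basis_exteriorPower_antiInvOne hW hα e θ p
  have hQ : algebraMap (PolyFun V) (RatFun V) (definingPoly W α) ≠ 0 :=
    (map_ne_zero_iff _ algebraMap_ratFun_injective).2 (definingPoly_ne_zero hα hW)
  have h : ∀ I, antiInvToRat W p (b I) =
      (algebraMap (PolyFun V) (RatFun V) (definingPoly W α) ^ (1 - (p : ℤ)) • wedgePow W p)
        (c I) := by
    intro I
    rw [LinearMap.smul_apply, hb, hc]
    exact (zpow_one_sub_smul_pow_smul (N := ⋀[RatFun V]^p (RatOneForm V)) hQ p _).symm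
  ext y
  rw [Set.mem_smul_set]
  constructor
  · rintro ⟨x, hx, rfl⟩
    obtain ⟨z, hz⟩ := exists_eq_of_basis _ _ b c h ⟨x, hx⟩
    exact ⟨_, ⟨_, z.2, rfl⟩, congrArg Subtype.val hz⟩
  · rintro ⟨_, ⟨x, hx, rfl⟩, rfl⟩
    obtain ⟨z, hz⟩ := exists_eq_of_basis _ _ c b (fun I => (h I).symm) ⟨x, hx⟩
    exact ⟨_, z.2, congrArg Subtype.val hz⟩

include e in
theorem existsUnique_isDualFamily :
    ∃! ω : Fin ℓ → RatOneForm V, IsDualFamily (fun i => (θ i : Der V)) ω :=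
  ⟨dualForms hW hα e θ, (isDualFamily_iff e θ _ _).2 rfl,
    fun _ hω => (isDualFamily_iff e θ (det_coeffMatrix_ne_zero hW hα e θ) _).1 hω⟩

end

end ReflForms
end

open ReflForms in
theorem theorem3 {V : Type*} [NormedAddCommGroup V] [InnerProductSpace ℂ V]
    [FiniteDimensional ℂ V] (ℓ : ℕ) (hℓ : finrank ℂ V = ℓ)
    (W : Subgroup (V ≃ₗ[ℂ] V)) (hW : IsUnitaryReflectionGroup W)
    (α : Submodule ℂ V → Dual ℂ V) (hα : ∀ H ∈ hyperplanes W, LinearMap.ker (α H) = H)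
    (Q : RatFun V) (hQ : Q = algebraMap (PolyFun V) (RatFun V) (definingPoly W α)) :
    (∀ p : ℕ, p ≤ ℓ →
      Set.InjOn (wedge W) (⋀[invariantRing W]^p (antiInvOne W)) ∧
      toRat '' (antiInv W p : Set (Form V)) =
        Q ^ (1 - (p : ℤ)) • (wedge W '' (⋀[invariantRing W]^p (antiInvOne W)))) ∧
    Nonempty (Basis (Fin ℓ) (invariantRing W) (invDer W)) ∧
    ∀ θ : Basis (Fin ℓ) (invariantRing W) (invDer W),
      (∃! ω : Fin ℓ → RatOneForm V, IsDualFamily (fun i => (θ i : Der V)) ω) ∧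
      ∀ ω : Fin ℓ → RatOneForm V, IsDualFamily (fun i => (θ i : Der V)) ω →
        ∀ p : ℕ, p ≤ ℓ →
          ∃ (b : Basis (Fin p ↪o Fin ℓ) (invariantRing W) (antiInv W p))
            (c : Basis (Fin p ↪o Fin ℓ) (invariantRing W)
              (⋀[invariantRing W]^p (antiInvOne W))),
            ∀ I : Fin p ↪o Fin ℓ,
              toRat (b I : Form V) = Q • ExteriorAlgebra.ιMulti (RatFun V) p (fun k => ω (I k)) ∧
              Q ^ (1 - (p : ℤ)) • wedge W (c I) =
                Q • ExteriorAlgebra.ιMulti (RatFun V) p (fun k => ω (I k)) := by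
  subst hQ
  let e : Basis (Fin ℓ) ℂ V := (Module.finBasis ℂ V).reindex (finCongr hℓ)
  obtain ⟨θ₀⟩ := exists_basis_invDer W hW hℓ
  refine ⟨fun p _ => ⟨injOn_wedge hW hα e θ₀ p, image_antiInv hW hα e θ₀ p⟩, ⟨θ₀⟩, fun θ =>
    ⟨existsUnique_isDualFamily hW hα e θ, fun ω hω p _ => ?_⟩⟩
  -- By uniqueness of the dual family, ω is the basis `dualForms`.
  obtain rfl := (isDualFamily_iff e θ (det_coeffMatrix_ne_zero hW hα e θ) ω).1 hω
  exact exists_bases hW hα e θ p
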